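/- Let $G$ be a compact topological group, let $u : G \to \mathrm{U}(d)$ be a continuous unitary representation, and let $0 \le k \le n$ be integers. Let $G$ act on $n$ qudits $\mathcal{H} = (\mathbb{C}^d)^{\otimes n}$ by $U(g) = u(g)^{\otimes n}$. A unitary on $\mathcal{H}$ is $G$-invariant if it commutes with $U(g)$ for all $g \in G$, and $k$-local if it acts non-trivially on at most $k$ qudits, i.e. has the form $A_S \otimes \mathbb{I}_{S^c}$ for a set $S$ of at most $k$ qudits. Let $\mathcal{V}^G_{n,k}$ be the group generated by all $k$-local $G$-invariant unitaries, so that $\mathcal{V}^G_{n,n}$ is the group of all $G$-invariant unitaries. Assume that $k$-local $G$-invariant gates are semi-universal, that is, the commutator subgroup $[\mathcal{V}^G_{n,n}, \mathcal{V}^G_{n,n}]$ is contained in $\mathcal{V}^G_{n,k}$. For $j \in \{k, n\}$ let $\mathrm{Irreps}_G(j)$ be the finite set of equivalence classes of irreducible representations of $G$ that appear in $u^{\otimes j}$, and write $f_\lambda$ for the character of $\lambda$. For $\lambda \in \mathrm{Irreps}_G(n)$ let $m_\lambda$ be the multiplicity of $\lambda$ in $u^{\otimes n}$. For $\nu \in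 \mathrm{Irreps}_G(k)$ and $\lambda \in \mathrm{Irreps}_G(n)$ put $$\mathbf{S}_{\nu,\lambda} = s_\nu(\lambda) = \int_G \mathrm{d}g\, [\operatorname{Tr} u(g)]^{n-k}\, \overline{f_\lambda(g)}\, f_\nu(g),$$ where $\mathrm{d}g$ is the normalized Haar measure of $G$. A probability distribution $\mu$ on the unitaries of $\mathcal{H}$ is a $t$-design for another one $\mu'$ if $\mathbb{E}_{V\sim\mu}[V^{\otimes t} \otimes {V^*}^{\otimes t}] = \mathbb{E}_{V\sim\mu'}[V^{\otimes t} \otimes {V^*}^{\otimes t}]$, where $V^*$ is the entrywise complex conjugate of $V$. Then the numbers $s_\nu(\lambda)$ are non-negative integers; the groups $\mathcal{V}^G_{n,k}$ and $\mathcal{V}^G_{n,n}$ are compact, and so have normalized Haar measures; and there is $t_{\max} \in \{0, 1, 2, \dots\} \cup \{\infty\}$ such that, for every integer $t \ge 0$, the Haar measure of $\mathcal{V}^G_{n,k}$ is a $t$-design for the Haar measure of $\mathcal{V}^G_{n,n}$ if and only if $t \le t_{\max}$. If some non-zero $\mathbf{q} \in \mathbb{Z}^{\mathrm{Irreps}_G(n)}$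 satisfies $\mathbf{S}\mathbf{q} = \mathbf{0}$, then $t_{\max}$ is finite and $$t_{\max} = \min\Big\{ \tfrac12 \sum_{\lambda \in \mathrm{Irreps}_G(n)} m_\lambda |q(\lambda)| - 1 \;:\; \mathbf{q} \in \mathbb{Z}^{\mathrm{Irreps}_G(n)},\ \mathbf{q} \ne \mathbf{0},\ \mathbf{S}\mathbf{q} = \mathbf{0} \Big\};$$ if there is no such $\mathbf{q}$, then $t_{\max} = \infty$. -/

import Mathlib

open MeasureTheory
open scoped Matrix

noncomputable section

namespace SymmetricDesign

/-! ### Tensor powers of matrices -/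

section TensorPower

variable {X : Type*} [Fintype X] [DecidableEq X]

/-- The tensor power `A^{⊗ n}` of a square matrix, as a multiplicative map; the standard basis
of the `n`-fold tensor power of `ℂ^X` is indexed by `Fin n → X`. -/
def tensorPow (n : ℕ) : Matrix X X ℂ →* Matrix (Fin n → X) (Fin n → X) ℂ where
  toFun A := Matrix.of fun x y => ∏ i, A (x i) (y i)
  map_one' := by
    ext x y
    simp only [Matrix.of_apply, Matrix.one_apply, Finset.prod_ite_zero, Finset.prod_const_one,
      Finset.mem_univ, true_implies, funext_iff]
  map_mul' A B := by
    ext x y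
    simp only [Matrix.of_apply, Matrix.mul_apply]
    rw [Finset.prod_univ_sum, Fintype.piFinset_univ]
    simp only [Finset.prod_mul_distrib]

end TensorPower

/-! ### Irreducible representations occurring in a representation -/

section Irreps

variable {G H : Type*} [Group G] [AddCommGroup H] [Module ℂ H]

/-- Equivalence of representations, on the irreducible subrepresentations of `ρ`. -/
def irrepSetoid (ρ : Representation ℂ G H) :
    Setoid {W : Subrepresentation ρ // W.toRepresentation.IsIrreducible} where
  r W W' := Nonempty (W.1.toRepresentation.Equiv W'.1.toRepresentation)
  iseqv := ⟨fun _ => ⟨.refl _⟩, fun ⟨e⟩ => ⟨e.symm⟩, fun ⟨e⟩ ⟨f⟩ => ⟨e.trans f⟩⟩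

/-- The set of equivalence classes of irreducible representations of `G` that appear in `ρ`. -/
def Irreps (ρ : Representation ℂ G H) : Type _ := Quotient (irrepSetoid ρ)

/-- A representative of the class `l`: an irreducible subrepresentation of `ρ`. -/
def Irreps.rep {ρ : Representation ℂ G H} (l : Irreps ρ) : Subrepresentation ρ :=
  (Quotient.out l).1

/-- The character `f_λ` of the irreducible representation `λ`. -/
def Irreps.char {ρ : Representation ℂ G H} (l : Irreps ρ) : G → ℂ :=
  l.rep.toRepresentation.character

/-- The multiplicity `m_λ` of the irreducible representation `λ` in `ρ`, that is, the dimension of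
the multiplicity space `Hom_G(λ, ρ)`. -/
def Irreps.mult {ρ : Representation ℂ G H} (l : Irreps ρ) : ℕ :=
  Module.finrank ℂ (l.rep.toRepresentation.IntertwiningMap ρ)

/-- Only finitely many irreducible representations appear in a finite-dimensional one. -/
instance Irreps.instFinite (ρ : Representation ℂ G H) [FiniteDimensional ℂ H] :
    Finite (Irreps ρ) := by
  let R := MonoidAlgebra ℂ G
  have hnoeth : IsNoetherian R ρ.asModule := by
    have : IsNoetherian ℂ H := inferInstance
    have h1 : WellFoundedGT (Submodule ℂ H) := inferInstance
    have h2 : WellFoundedGT (Subrepresentation ρ) := by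
      have hm : StrictMono (Subrepresentation.toSubmodule : Subrepresentation ρ → Submodule ℂ H) :=
        fun a b hab => hab
      exact hm.wellFoundedGT
    have h3 : WellFoundedGT (Submodule R ρ.asModule) :=
      (Subrepresentation.subrepresentationSubmoduleOrderIso (ρ := ρ)).symm.strictMono.wellFoundedGT
    exact isNoetherian_iff'.mpr h3
  have hsimple (W : Subrepresentation ρ) (hW : W.toRepresentation.IsIrreducible) :
      IsSimpleModule R W.asSubmodule := by
    rw [isSimpleModule_iff_isAtom]
    refine (OrderIso.isAtom_iff
      (Subrepresentation.subrepresentationSubmoduleOrderIso (ρ := ρ)) W).mpr ⟨?_, ?_⟩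
    · rintro rfl
      refine hW.exists_pair_ne.elim fun A ⟨B, hAB⟩ => hAB ?_
      have : Subsingleton (⊥ : Subrepresentation ρ).toSubmodule :=
        inferInstanceAs (Subsingleton (⊥ : Submodule ℂ H))
      exact Subrepresentation.toSubmodule_injective (Subsingleton.elim _ _)
    · intro W' hlt
      let T : Subrepresentation W.toRepresentation :=
        ⟨W'.toSubmodule.comap W.toSubmodule.subtype,
          fun g v hv => W'.apply_mem_toSubmodule g hv⟩
      rcases hW.eq_bot_or_eq_top T with hT | hT
      · apply Subrepresentation.toSubmodule_injective
        refine (Submodule.eq_bot_iff _).mpr fun x hx => ?_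
        have hxT : (⟨x, hlt.le hx⟩ : W.toSubmodule) ∈ T.toSubmodule := hx
        rw [hT] at hxT
        exact congrArg Subtype.val ((Submodule.mem_bot ℂ).mp hxT)
      · refine absurd (fun x hx => ?_) (not_le_of_gt hlt)
        have hxT : (⟨x, hx⟩ : W.toSubmodule) ∈ T.toSubmodule := by
          rw [hT]; exact Submodule.mem_top
        exact hxT
  let F : Irreps ρ → isotypicComponents R ρ.asModule := fun l =>
    ⟨isotypicComponent R ρ.asModule (Quotient.out l).1.asSubmodule,
      (Quotient.out l).1.asSubmodule, hsimple _ (Quotient.out l).2, rfl⟩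
  refine Finite.of_injective F fun l l' h => ?_
  have h' : isotypicComponent R ρ.asModule (Quotient.out l).1.asSubmodule
    = isotypicComponent R ρ.asModule (Quotient.out l').1.asSubmodule := congrArg Subtype.val h
  have i1 := hsimple _ (Quotient.out l).2
  have i2 := hsimple _ (Quotient.out l').2
  have hle : (Quotient.out l).1.asSubmodule ≤
      isotypicComponent R ρ.asModule (Quotient.out l').1.asSubmodule :=
    h' ▸ Submodule.le_isotypicComponent _
  obtain ⟨e⟩ := (isIsotypicOfType_submodule_iff.mp
    (IsIsotypicOfType.isotypicComponent R ρ.asModule (Quotient.out l').1.asSubmodule)) _ hle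
  rw [← Quotient.out_eq l, ← Quotient.out_eq l']
  refine Quotient.sound ⟨Representation.Equiv.mk (e.restrictScalars ℂ) fun g => ?_⟩
  refine LinearMap.ext fun w => ?_
  have hw := e.map_smul (MonoidAlgebra.single g (1 : ℂ)) w
  have hs (W : Subrepresentation ρ) (x : W.asSubmodule) :
      (MonoidAlgebra.single g (1 : ℂ) : R) • x = W.toRepresentation g x := by
    refine Subtype.ext ?_
    refine (Representation.single_smul (ρ := ρ) (1 : ℂ) g x.1).trans ?_
    exact one_smul ℂ _
  exact (congrArg e (hs _ w)).symm.trans (hw.trans (hs _ (e w)))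

instance Irreps.instFintype (ρ : Representation ℂ G H) [FiniteDimensional ℂ H] :
    Fintype (Irreps ρ) := Fintype.ofFinite _

end Irreps

/-! ### Unitary designs -/

section Designs

variable {X : Type*} [Fintype X] [DecidableEq X]

instance instMeasurableSpaceUnitary : MeasurableSpace (Matrix.unitaryGroup X ℂ) := borel _

instance instBorelSpaceUnitary : BorelSpace (Matrix.unitaryGroup X ℂ) := ⟨rfl⟩

/-- `μ` is the uniform distribution over the group `W` of unitaries: the normalized Haar measure
of `W`, regarded as a distribution on the unitary group. -/
def IsUniformOn (W : Subgroup (Matrix.unitaryGroup X ℂ))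
    (μ : Measure (Matrix.unitaryGroup X ℂ)) : Prop :=
  ∃ η : Measure W, η.IsHaarMeasure ∧ IsProbabilityMeasure η ∧ μ = η.map Subtype.val

/-- The `t`-th moment `E_{V ∼ μ} [V^{⊗ t} ⊗ (V^*)^{⊗ t}]`, where `V^*` is the entrywise complex
conjugate of `V`; the integral is taken entrywise. -/
def moment (t : ℕ) (μ : Measure (Matrix.unitaryGroup X ℂ)) :
    Matrix ((Fin t → X) × (Fin t → X)) ((Fin t → X) × (Fin t → X)) ℂ :=
  Matrix.of fun a b => ∫ V, Matrix.kroneckerMap (· * ·)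
    (tensorPow t (V : Matrix X X ℂ)) (tensorPow t ((V : Matrix X X ℂ).map star)) a b ∂μ

/-- `μ` is a `t`-design for `ν`. -/
def IsTDesign (t : ℕ) (μ ν : Measure (Matrix.unitaryGroup X ℂ)) : Prop :=
  moment t μ = moment t ν

/-- The supremum in `ℕ ∪ {∞}` of all `t` such that `μ` is a `t`-design for `ν`. -/
def tMax (μ ν : Measure (Matrix.unitaryGroup X ℂ)) : ℕ∞ :=
  ⨆ (t : ℕ) (_ : IsTDesign t μ ν), (t : ℕ∞)

end Designs

/-! ### Symmetric quantum circuits on `n` qudits -/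

section Circuits

variable {G : Type*} [Group G] {d : ℕ}

/-- The on-site representation `U(g) = u(g)^{⊗ n}` on `(ℂ^d)^{⊗ n}`. -/
def onSiteRep (u : G →* Matrix.unitaryGroup (Fin d) ℂ) (n : ℕ) :
    Representation ℂ G ((Fin n → Fin d) → ℂ) where
  toFun g := Matrix.toLin' (tensorPow n (u g : Matrix (Fin d) (Fin d) ℂ))
  map_one' := by simp [Module.End.one_eq_id]
  map_mul' g h := by simp [Matrix.toLin'_mul, Module.End.mul_eq_comp]

/-- `V` is `k`-local: for some set `S` of at most `k` qudits, `V = A ⊗ 1` with `A` an operator on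
the qudits in `S` and `1` the identity on all the others. -/
def IsLocal {n : ℕ} (k : ℕ) (V : Matrix (Fin n → Fin d) (Fin n → Fin d) ℂ) : Prop :=
  ∃ S : Finset (Fin n), S.card ≤ k ∧ ∃ A : Matrix (S → Fin d) (S → Fin d) ℂ,
    ∀ x y, V x y = if ∀ i, i ∉ S → x i = y i then A (fun i => x i) (fun i => y i) else 0

/-- `V` is `G`-invariant: `[V, u(g)^{⊗ n}] = 0` for all `g`. -/
def IsInvariant (u : G →* Matrix.unitaryGroup (Fin d) ℂ) {n : ℕ}
    (V : Matrix (Fin n → Fin d) (Fin n → Fin d) ℂ) : Prop :=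
  ∀ g, Commute V (tensorPow n (u g : Matrix (Fin d) (Fin d) ℂ))

/-- The group `𝒱^G_{n,k}` generated by the `k`-local `G`-invariant unitaries on `n` qudits. -/
def circuitGroup (u : G →* Matrix.unitaryGroup (Fin d) ℂ) (n k : ℕ) :
    Subgroup (Matrix.unitaryGroup (Fin n → Fin d) ℂ) :=
  Subgroup.closure {V | IsInvariant u V.1 ∧ IsLocal k V.1}

/-- The `k`-local `G`-invariant gates on `n` qudits are semi-universal: `𝒱^G_{n,k}` contains the
commutator subgroup of `𝒱^G_{n,n}`. -/
def IsSemiUniversal (u : G →* Matrix.unitaryGroup (Fin d) ℂ) (n k : ℕ) : Prop :=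
  ⁅circuitGroup u n n, circuitGroup u n n⁆ ≤ circuitGroup u n k

/-- `𝒱^G_{n,n}` is the group of all `G`-invariant unitaries. -/
theorem mem_circuitGroup_self (u : G →* Matrix.unitaryGroup (Fin d) ℂ) (n : ℕ)
    (V : Matrix.unitaryGroup (Fin n → Fin d) ℂ) :
    V ∈ circuitGroup u n n ↔ IsInvariant u V.1 := by
  constructor
  · intro hV
    induction hV using Subgroup.closure_induction with
    | mem V hV => exact hV.1
    | one => exact fun g => Commute.one_left _
    | mul V W _ _ hV hW => exact fun g => (hV g).mul_left (hW g)
    | inv V _ hV =>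
      intro g
      have h1 : (V⁻¹).1 * V.1 = 1 := congrArg Subtype.val (inv_mul_cancel V)
      have h2 : V.1 * (V⁻¹).1 = 1 := congrArg Subtype.val (mul_inv_cancel V)
      have h := hV g
      unfold Commute SemiconjBy at h ⊢
      calc (V⁻¹).1 * tensorPow n (u g).1
          = (V⁻¹).1 * (tensorPow n (u g).1 * V.1) * (V⁻¹).1 := by
            rw [mul_assoc, mul_assoc, h2, mul_one]
        _ = tensorPow n (u g).1 * (V⁻¹).1 := by
            rw [← h, ← mul_assoc, h1, one_mul]
  · intro hV
    refine Subgroup.subset_closure ⟨hV, Finset.univ, by simp,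
      fun a b => V.1 (fun i => a ⟨i, Finset.mem_univ i⟩) (fun i => b ⟨i, Finset.mem_univ i⟩), ?_⟩
    simp

/-- The pairing `m · |q| = ∑_λ m_λ |q(λ)|`. -/
def multDotAbs {u : G →* Matrix.unitaryGroup (Fin d) ℂ} {n : ℕ}
    (q : Irreps (onSiteRep u n) → ℤ) : ℤ :=
  ∑ l, (l.mult : ℤ) * |q l|

variable [TopologicalSpace G] [IsTopologicalGroup G] [CompactSpace G] [MeasurableSpace G]
  [BorelSpace G]

/-- The matrix `S`, with entries
`s_ν(λ) = ∫ (Tr u(g))^{n-k} conj(f_λ(g)) f_ν(g) dg` (normalized Haar measure of `G`). -/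
def sMatrix (u : G →* Matrix.unitaryGroup (Fin d) ℂ) (n k : ℕ) :
    Matrix (Irreps (onSiteRep u k)) (Irreps (onSiteRep u n)) ℂ :=
  Matrix.of fun ν l => ∫ g, (u g : Matrix (Fin d) (Fin d) ℂ).trace ^ (n - k) *
    star (l.char g) * ν.char g ∂(Measure.haarMeasure (⊤ : TopologicalSpace.PositiveCompacts G))

/-- The admissible vectors: `q ∈ ℤ^{Irreps_G(n)}` with `q ≠ 0` and `S q = 0`. -/
def nullVectors (u : G →* Matrix.unitaryGroup (Fin d) ℂ) (n k : ℕ) :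
    Set (Irreps (onSiteRep u n) → ℤ) :=
  {q | q ≠ 0 ∧ sMatrix u n k *ᵥ (fun l => (q l : ℂ)) = 0}

end Circuits

end SymmetricDesign

end

open SymmetricDesign

/-!
Put `U(g) = u(g)^{⊗ n}`. An operator that commutes with `U` acts on every multiplicity space
`Hom_G(λ, U)`, so that an invariant unitary `V` has determinants `phase λ V` on these spaces. The
space of `U` is an orthogonal sum of irreducible subrepresentations
(`exists_orthogonal_decomposition`), and the group of all invariant unitaries is generated by the
gates that multiply one irreducible subrepresentation by a phase (`invGroup_induction`). Gates of
equivalent subrepresentations are conjugate, whence every homomorphism to a commutative group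
factors through the determinants (`map_eq_prod_repGate_phase`), and the commutator subgroup consists
of the invariant unitaries with all determinants equal to `1`.

For an invariant unitary `A` on `k` qudits, `phase λ (A ⊗ 1) = ∏_ν (phase ν A)^{s_ν(λ)}`
(`phase_embU`), because `s_ν(λ)` is the multiplicity of `λ` in `ν ⊗ u^{⊗ (n-k)}`
(`sMatrix_eq_blockRank`). Under semi-universality the group generated by the local invariant
unitaries is therefore the preimage, under the determinants, of the torus parametrized by `S`
(`mem_circuitGroup_iff`); in particular it is compact. The character `∏_λ (phase λ)^{q(λ)}` is
trivial on it if and only if `S q = 0` (`sMatrix_mulVec_eq_zero_iff`).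

If the moments of degree `t` of the two groups differ, then some vector in the space of
`V^{⊗ t} ⊗ (V^*)^{⊗ t}` is fixed by the local circuits and not by all invariant unitaries. As the
local circuits contain all commutators, the invariant unitaries act on the vectors fixed by the
local circuits by commuting unitaries, and a nontrivial character that is trivial on the local
circuits occurs there (`exists_character_of_not_fixed`). It is `∏_λ (phase λ)^{q(λ)}` for some `q`,
and comparing weights under the phase gates gives `∑_λ m_λ |q(λ)| ≤ 2 t` (`exists_eq_blockChar`).
Conversely, for every `q` the character `∏_λ (phase λ)^{q(λ)}` is a polynomial of degree
`∑_λ m_λ q⁺(λ)` in the entries of `V` and of degree `∑_λ m_λ q⁻(λ)` in their conjugates; if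
`S q = 0` then both degrees equal `∑_λ m_λ |q(λ)| / 2`, since the global phases are local gates. If
`q ≠ 0` and this degree is at most `t`, the means of this polynomial over the two groups are `1` and
`0`, so that there is no `t`-design. Together these give `isTDesign_iff`.
-/

noncomputable section

namespace SymmetricDesign

/-! ### Unitary representations and their commutants -/

section MatrixRep

variable {X : Type*} [Fintype X] [DecidableEq X] {G : Type*} [Group G]

/-- The representation on `ℂ^X` given by a group of unitary matrices. -/
def matRep (U : G →* Matrix.unitaryGroup X ℂ) : Representation ℂ G (X → ℂ) where
  toFun g := Matrix.toLin' (U g : Matrix X X ℂ)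
  map_one' := by simp [Module.End.one_eq_id]
  map_mul' g h := by simp [Matrix.toLin'_mul, Module.End.mul_eq_comp]

theorem matRep_apply (U : G →* Matrix.unitaryGroup X ℂ) (g : G) (x : X → ℂ) :
    matRep U g x = (U g : Matrix X X ℂ) *ᵥ x := rfl

/-- The commutant of a group of unitary matrices. -/
def commutant (U : G →* Matrix.unitaryGroup X ℂ) : Subalgebra ℂ (Matrix X X ℂ) :=
  Subalgebra.centralizer ℂ (Set.range fun g => (U g : Matrix X X ℂ))

variable {U : G →* Matrix.unitaryGroup X ℂ}

theorem mem_commutant {A : Matrix X X ℂ} :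
    A ∈ commutant U ↔ ∀ g, (U g : Matrix X X ℂ) * A = A * (U g : Matrix X X ℂ) := by
  simp [commutant, Subalgebra.mem_centralizer_iff]

theorem star_coe_eq_inv (g : G) : star (U g : Matrix X X ℂ) = (U g⁻¹ : Matrix X X ℂ) := by
  rw [map_inv]; rfl

theorem star_mem_commutant {A : Matrix X X ℂ} (hA : A ∈ commutant U) : star A ∈ commutant U := by
  rw [mem_commutant] at hA ⊢
  intro g
  have h := congrArg star (hA g⁻¹)
  rw [star_mul, star_mul, star_coe_eq_inv, inv_inv] at h
  exact h.symm

/-- Every subspace of `ℂ^X` is the range of an orthogonal projection. -/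
theorem exists_isStarProjection (W : Submodule ℂ (X → ℂ)) :
    ∃ P : Matrix X X ℂ, IsStarProjection P ∧ (∀ x, P *ᵥ x ∈ W) ∧ ∀ x ∈ W, P *ᵥ x = x := by
  let e := (WithLp.linearEquiv 2 ℂ (X → ℂ)).symm
  let W' : Submodule ℂ (EuclideanSpace ℂ X) := W.map e.toLinearMap
  let P := (Matrix.toEuclideanCLM (n := X) (𝕜 := ℂ)).symm W'.starProjection
  have hP : Matrix.toEuclideanCLM (n := X) (𝕜 := ℂ) P = W'.starProjection :=
    StarAlgEquiv.apply_symm_apply _ _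
  have happ (x : X → ℂ) : e (P *ᵥ x) = W'.starProjection (e x) := by
    rw [← hP]; rfl
  refine ⟨P, ⟨?_, ?_⟩, fun x => ?_, fun x hx => ?_⟩
  · apply EquivLike.injective (Matrix.toEuclideanCLM (n := X) (𝕜 := ℂ))
    rw [map_mul, hP]
    exact isStarProjection_starProjection.isIdempotentElem
  · apply EquivLike.injective (Matrix.toEuclideanCLM (n := X) (𝕜 := ℂ))
    rw [map_star, hP]
    exact isStarProjection_starProjection.isSelfAdjoint
  · have h : e (P *ᵥ x) ∈ W' := by
      rw [happ]; exact Submodule.starProjection_apply_mem _ _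
    obtain ⟨y, hy, hyx⟩ := h
    exact e.injective hyx ▸ hy
  · apply e.injective
    rw [happ]
    exact Submodule.starProjection_eq_self_iff.mpr ⟨x, hx, rfl⟩

/-- The matrix of the orthogonal projection onto a subrepresentation. -/
def projMat (W : Subrepresentation (matRep U)) : Matrix X X ℂ :=
  (exists_isStarProjection W.toSubmodule).choose

variable (W W' : Subrepresentation (matRep U))

theorem projMat_isStarProjection : IsStarProjection (projMat W) :=
  (exists_isStarProjection W.toSubmodule).choose_spec.1

theorem projMat_mulVec_mem (x : X → ℂ) : projMat W *ᵥ x ∈ W.toSubmodule :=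
  (exists_isStarProjection W.toSubmodule).choose_spec.2.1 x

variable {W} in
theorem projMat_mulVec_of_mem {x : X → ℂ} (hx : x ∈ W.toSubmodule) : projMat W *ᵥ x = x :=
  (exists_isStarProjection W.toSubmodule).choose_spec.2.2 x hx

theorem star_projMat : star (projMat W) = projMat W := (projMat_isStarProjection W).isSelfAdjoint

theorem projMat_mul_self : projMat W * projMat W = projMat W :=
  (projMat_isStarProjection W).isIdempotentElem

variable {W} in
theorem projMat_mul_of_forall_mem {A : Matrix X X ℂ} (hA : ∀ x, A *ᵥ x ∈ W.toSubmodule) :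
    projMat W * A = A := by
  refine Matrix.ext_of_mulVec_single fun i => ?_
  rw [← Matrix.mulVec_mulVec, projMat_mulVec_of_mem (hA _)]

/-- The orthogonal complement of a subrepresentation is invariant as well, since the adjoints of the
matrices in the group belong to the group. -/
theorem projMat_mem_commutant : projMat W ∈ commutant U := by
  have h1 (g : G) : projMat W * ((U g : Matrix X X ℂ) * projMat W) =
      (U g : Matrix X X ℂ) * projMat W := by
    refine projMat_mul_of_forall_mem fun x => ?_
    rw [← Matrix.mulVec_mulVec]
    exact W.apply_mem_toSubmodule g (projMat_mulVec_mem W x)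
  rw [mem_commutant]
  intro g
  have h2 := congrArg star (h1 g⁻¹)
  rw [star_mul, star_mul, star_projMat, star_coe_eq_inv, inv_inv] at h2
  rw [← h1 g, ← mul_assoc, h2]

/-- **Schur's lemma**: the commutant compresses to scalars on an irreducible subrepresentation. -/
theorem exists_projMat_mul_mul_eq_smul (hW : W.toRepresentation.IsIrreducible)
    {A : Matrix X X ℂ} (hA : A ∈ commutant U) :
    ∃ c : ℂ, projMat W * A * projMat W = c • projMat W := by
  rw [mem_commutant] at hA
  have hP := mem_commutant.mp (projMat_mem_commutant W)
  let f : W.toRepresentation.IntertwiningMap W.toRepresentation :=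
    ⟨((Matrix.toLin' (projMat W * A)).domRestrict W.toSubmodule).codRestrict W.toSubmodule
      (fun x => by
        show (projMat W * A) *ᵥ _ ∈ _
        rw [← Matrix.mulVec_mulVec]; exact projMat_mulVec_mem W _), by
      intro g
      ext1 x
      apply Subtype.ext
      show (projMat W * A) *ᵥ ((U g : Matrix X X ℂ) *ᵥ x.1) =
        (U g : Matrix X X ℂ) *ᵥ ((projMat W * A) *ᵥ x.1)
      rw [Matrix.mulVec_mulVec, Matrix.mulVec_mulVec, ← mul_assoc, hP, mul_assoc, mul_assoc, hA]⟩
  obtain ⟨c, hc⟩ :=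
    Representation.IsIrreducible.algebraMap_intertwiningMap_bijective_of_isAlgClosed.2 f
  refine ⟨c, Matrix.ext_of_mulVec_single fun i => ?_⟩
  have h := congrArg (fun F => (F ⟨_, projMat_mulVec_mem W (Pi.single i 1)⟩).1) hc
  rw [← Matrix.mulVec_mulVec, Matrix.smul_mulVec]
  exact h.symm

/-- A nonzero subspace invariant under the group contains an irreducible one. -/
theorem exists_irreducible_le {T : Subrepresentation (matRep U)} (hT : T.toSubmodule ≠ ⊥) :
    ∃ W : Subrepresentation (matRep U), W.toRepresentation.IsIrreducible ∧
      W.toSubmodule ≤ T.toSubmodule := by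
  induction h : Module.finrank ℂ T.toSubmodule using Nat.strong_induction_on generalizing T with
  | _ m ih =>
  by_cases hirr : T.toRepresentation.IsIrreducible
  · exact ⟨T, hirr, le_rfl⟩
  have hnt : Nontrivial (Subrepresentation T.toRepresentation) := by
    refine ⟨⊥, ⊤, fun hbt => hT ((Submodule.eq_bot_iff _).mpr fun x hx => ?_)⟩
    have hx' : (⟨x, hx⟩ : T.toSubmodule) ∈ (⊤ : Subrepresentation T.toRepresentation).toSubmodule :=
      Submodule.mem_top
    rw [← hbt] at hx'
    exact congrArg Subtype.val ((Submodule.mem_bot ℂ).mp hx')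
  have hex : ∃ R : Subrepresentation T.toRepresentation, ¬ (R = ⊥ ∨ R = ⊤) := by
    by_contra hcon
    push Not at hcon
    exact hirr { eq_bot_or_eq_top := hcon }
  obtain ⟨R, hR⟩ := hex
  push Not at hR
  let R' : Subrepresentation (matRep U) :=
    ⟨R.toSubmodule.map T.toSubmodule.subtype, by
      rintro g _ ⟨x, hx, rfl⟩
      exact ⟨T.toRepresentation g x, R.apply_mem_toSubmodule g hx, rfl⟩⟩
  have hle : R'.toSubmodule ≤ T.toSubmodule := Submodule.map_subtype_le _ _
  have hne : R'.toSubmodule ≠ ⊥ := by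
    intro hb
    refine hR.1 (Subrepresentation.toSubmodule_injective ?_)
    refine (Submodule.eq_bot_iff _).mpr fun x hx => Subtype.ext ?_
    exact (Submodule.eq_bot_iff _).mp hb x.1 ⟨x, hx, rfl⟩
  have hlt : R'.toSubmodule < T.toSubmodule := by
    refine lt_of_le_of_ne hle fun he => hR.2 (Subrepresentation.toSubmodule_injective ?_)
    refine (Submodule.eq_top_iff').mpr fun x => ?_
    have hx : x.1 ∈ R'.toSubmodule := he.ge x.2
    obtain ⟨y, hy, hyx⟩ := hx
    obtain rfl : y = x := Subtype.ext hyx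
    exact hy
  obtain ⟨W, hW, hWle⟩ := ih _ (h ▸ Submodule.finrank_lt_finrank_of_lt hlt) hne rfl
  exact ⟨W, hW, hWle.trans hle⟩

end MatrixRep

/-! ### Orthogonal decomposition into irreducible subrepresentations -/

section Vectors

variable {X : Type*} [Fintype X]

theorem star_dotProduct_self (v : X → ℂ) : star v ⬝ᵥ v = ((∑ i, ‖v i‖ ^ 2 : ℝ) : ℂ) := by
  simp [dotProduct, Complex.conj_mul']

theorem sum_norm_sq_pos {v : X → ℂ} (hv : v ≠ 0) : 0 < ∑ i, ‖v i‖ ^ 2 := by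
  obtain ⟨i, hi⟩ := Function.ne_iff.mp hv
  exact Finset.sum_pos' (fun _ _ => by positivity) ⟨i, Finset.mem_univ i, by
    have : ‖v i‖ ≠ 0 := norm_ne_zero_iff.mpr hi
    positivity⟩

end Vectors

section Commutant

variable {X : Type*} [Fintype X] [DecidableEq X] {G : Type*} [Group G]
variable {U : G →* Matrix.unitaryGroup X ℂ}

theorem exists_ne_zero_of_isIrreducible {W : Subrepresentation (matRep U)}
    (hW : W.toRepresentation.IsIrreducible) : ∃ x ∈ W.toSubmodule, x ≠ 0 := by
  by_contra! hcon
  obtain ⟨A, B, hAB⟩ := hW.exists_pair_ne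
  refine hAB (Subrepresentation.toSubmodule_injective ?_)
  have : Subsingleton W.toSubmodule :=
    ⟨fun x y => Subtype.ext ((hcon x x.2).trans (hcon y y.2).symm)⟩
  exact Subsingleton.elim _ _

theorem projMat_ne_zero {W : Subrepresentation (matRep U)}
    (hW : W.toRepresentation.IsIrreducible) : projMat W ≠ 0 := by
  obtain ⟨x, hx, hx0⟩ := exists_ne_zero_of_isIrreducible hW
  intro h
  have := projMat_mulVec_of_mem hx
  rw [h, Matrix.zero_mulVec] at this
  exact hx0 this.symm

/-- The matrix of an intertwiner between two subrepresentations, extended by zero to the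
orthogonal complement. -/
theorem exists_matrix_of_intertwiningMap {W W' : Subrepresentation (matRep U)}
    (e : W.toRepresentation.IntertwiningMap W'.toRepresentation) :
    ∃ F ∈ commutant U, F * projMat W = F ∧ projMat W' * F = F ∧
      ∀ x : W.toSubmodule, F *ᵥ x.1 = (e x).1 := by
  let p : (X → ℂ) →ₗ[ℂ] W.toSubmodule :=
    (Matrix.toLin' (projMat W)).codRestrict W.toSubmodule (projMat_mulVec_mem W)
  let f : (X → ℂ) →ₗ[ℂ] (X → ℂ) := W'.toSubmodule.subtype ∘ₗ e.toLinearMap ∘ₗ p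
  have hF (x : X → ℂ) : LinearMap.toMatrix' f *ᵥ x = (e (p x)).1 := by
    rw [← Matrix.toLin'_apply, Matrix.toLin'_toMatrix']; rfl
  have hp (x : W.toSubmodule) : p x.1 = x := Subtype.ext (projMat_mulVec_of_mem x.2)
  refine ⟨LinearMap.toMatrix' f, ?_, ?_, ?_, ?_⟩
  · rw [mem_commutant]
    intro g
    refine Matrix.ext_of_mulVec_single fun i => ?_
    rw [← Matrix.mulVec_mulVec, ← Matrix.mulVec_mulVec, hF, hF]
    have h1 : p ((U g : Matrix X X ℂ) *ᵥ Pi.single i 1) =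
        W.toRepresentation g (p (Pi.single i 1)) := by
      apply Subtype.ext
      show projMat W *ᵥ ((U g : Matrix X X ℂ) *ᵥ Pi.single i 1) =
        (U g : Matrix X X ℂ) *ᵥ (projMat W *ᵥ Pi.single i 1)
      rw [Matrix.mulVec_mulVec, Matrix.mulVec_mulVec, mem_commutant.mp (projMat_mem_commutant W)]
    rw [h1, e.isIntertwining]
    rfl
  · refine Matrix.ext_of_mulVec_single fun i => ?_
    rw [← Matrix.mulVec_mulVec, hF, hF]
    exact congrArg (fun y => (e y).1) (hp (p (Pi.single i 1)))
  · refine projMat_mul_of_forall_mem fun x => ?_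
    rw [hF]
    exact (e (p x)).2
  · intro x
    rw [hF, hp]

/-- Equivalent irreducible subrepresentations are related by a partial isometry `F` in the
commutant. Its phase can be chosen such that `F` compresses to a real scalar on the source. -/
theorem exists_partialIsometry {W W' : Subrepresentation (matRep U)}
    (hW : W.toRepresentation.IsIrreducible) (hW' : W'.toRepresentation.IsIrreducible)
    (e : W.toRepresentation.Equiv W'.toRepresentation) :
    ∃ F ∈ commutant U, star F * F = projMat W ∧ F * star F = projMat W' ∧ F * projMat W = F ∧
      ∃ r : ℝ, projMat W * F * projMat W = (r : ℂ) • projMat W := by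
  obtain ⟨F₀, hF₀, hF₀P, hPF₀, hF₀e⟩ := exists_matrix_of_intertwiningMap e.toIntertwiningMap
  obtain ⟨c, hc⟩ := exists_projMat_mul_mul_eq_smul W hW (mul_mem (star_mem_commutant hF₀) hF₀)
  have hPs : projMat W * star F₀ = star F₀ := by
    have := congrArg star hF₀P
    rwa [star_mul, star_projMat] at this
  rw [← mul_assoc, hPs, mul_assoc, hF₀P] at hc
  -- evaluating at a unit vector shows that the scalar `c` is a positive real
  obtain ⟨x, hx, hx0⟩ := exists_ne_zero_of_isIrreducible hW
  have hFx : F₀ *ᵥ x ≠ 0 := by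
    have h1 : F₀ *ᵥ x = (e ⟨x, hx⟩).1 := hF₀e ⟨x, hx⟩
    rw [h1]
    intro h0
    have h2 : e ⟨x, hx⟩ = e 0 := by rw [map_zero]; exact Subtype.ext h0
    exact hx0 (congrArg Subtype.val (EquivLike.injective e h2))
  have hquad : star (F₀ *ᵥ x) ⬝ᵥ (F₀ *ᵥ x) = c * (star x ⬝ᵥ x) := by
    rw [Matrix.star_mulVec, ← Matrix.dotProduct_mulVec, Matrix.mulVec_mulVec,
      ← Matrix.star_eq_conjTranspose, hc, Matrix.smul_mulVec, projMat_mulVec_of_mem hx,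
      dotProduct_smul, smul_eq_mul]
  rw [star_dotProduct_self, star_dotProduct_self] at hquad
  obtain ⟨s, hs, rfl⟩ : ∃ s : ℝ, 0 < s ∧ (s : ℂ) = c := by
    refine ⟨_ / _, div_pos (sum_norm_sq_pos hFx) (sum_norm_sq_pos hx0), ?_⟩
    rw [Complex.ofReal_div, hquad, mul_div_assoc, div_self, mul_one]
    exact_mod_cast (sum_norm_sq_pos hx0).ne'
  -- normalize `F₀` to a partial isometry and rotate its phase
  obtain ⟨c₁, hc₁⟩ := exists_projMat_mul_mul_eq_smul W hW hF₀
  obtain ⟨w, hw, r, hr⟩ : ∃ w : ℂ, star w * w = 1 ∧ ∃ r : ℝ, w * c₁ = r := by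
    by_cases h0 : c₁ = 0
    · exact ⟨1, by simp, 0, by simp [h0]⟩
    · have hn : ((‖c₁‖ : ℝ) : ℂ) ≠ 0 := by exact_mod_cast norm_ne_zero_iff.mpr h0
      refine ⟨star c₁ / ‖c₁‖, ?_, ‖c₁‖, ?_⟩
      · have := Complex.mul_conj' c₁
        simp only [star_div₀, RCLike.star_def, Complex.conj_ofReal, Complex.conj_conj] at this ⊢
        field_simp
        rw [this]
      · have := Complex.conj_mul' c₁
        simp only [RCLike.star_def] at this ⊢
        field_simp
        rw [this]
  have hsq : ((√s : ℝ) : ℂ) * (√s : ℝ) = s := by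
    rw [← Complex.ofReal_mul, Real.mul_self_sqrt hs.le]
  have hs0 : ((√s : ℝ) : ℂ) ≠ 0 := by exact_mod_cast (Real.sqrt_pos.mpr hs).ne'
  let a : ℂ := w * ((√s : ℝ) : ℂ)⁻¹
  have ha : star a * a * s = 1 := by
    have h1 : star a = star w * ((√s : ℝ) : ℂ)⁻¹ := by simp [a]
    rw [h1, ← hsq]
    have : star w * ((√s : ℝ) : ℂ)⁻¹ * (w * ((√s : ℝ) : ℂ)⁻¹) * (((√s : ℝ) : ℂ) * (√s : ℝ)) =
      star w * w := by field_simp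
    rw [this, hw]
  have hFF : star (a • F₀) * (a • F₀) = projMat W := by
    rw [star_smul, smul_mul_smul_comm, hc, smul_smul, ha, one_smul]
  have hFP : (a • F₀) * projMat W = a • F₀ := by rw [smul_mul_assoc, hF₀P]
  have hPF : projMat W' * (a • F₀) = a • F₀ := by rw [mul_smul_comm, hPF₀]
  have hF0 : a • F₀ ≠ 0 := by
    intro h
    rw [h, mul_zero] at hFF
    exact projMat_ne_zero hW hFF.symm
  have hmem : a • F₀ ∈ commutant U := Subalgebra.smul_mem _ hF₀ a
  refine ⟨a • F₀, hmem, hFF, ?_, hFP, r * (√s)⁻¹, ?_⟩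
  · obtain ⟨c', hc'⟩ := exists_projMat_mul_mul_eq_smul W' hW'
      (mul_mem hmem (star_mem_commutant hmem))
    have hPs' : star (a • F₀) * projMat W' = star (a • F₀) := by
      have := congrArg star hPF
      rwa [star_mul, star_projMat] at this
    rw [← mul_assoc, hPF, mul_assoc, hPs'] at hc'
    have h1 : c' • (a • F₀) = a • F₀ := by
      rw [← hPF, ← smul_mul_assoc, ← hc', mul_assoc, hPF, hFF, hFP]
    have h2 : (c' - 1) • (a • F₀) = 0 := by rw [sub_smul, h1, one_smul, sub_self]
    rcases smul_eq_zero.mp h2 with h3 | h3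
    · rw [hc', sub_eq_zero.mp h3, one_smul]
    · exact absurd h3 hF0
  · rw [mul_smul_comm, smul_mul_assoc, hc₁, smul_smul]
    congr 1
    rw [Complex.ofReal_mul, Complex.ofReal_inv, ← hr]
    ring

open scoped ComplexOrder in
/-- Equivalent irreducible subrepresentations are conjugate under a unitary of the commutant. If
`F` is a partial isometry from `W` to `W'` with real compression `r` to `W`, then `w ↦ F w` on `W`
is the restriction of the reflection that negates the subspace `{w - F w}`, because `w - F w` and
`w + F w` are orthogonal. -/
theorem exists_unitary_conj_projMat {W W' : Subrepresentation (matRep U)}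
    (hW : W.toRepresentation.IsIrreducible) (hW' : W'.toRepresentation.IsIrreducible)
    (e : W.toRepresentation.Equiv W'.toRepresentation) :
    ∃ R : Matrix.unitaryGroup X ℂ, R.1 ∈ commutant U ∧
      R.1 * projMat W * star R.1 = projMat W' := by
  obtain ⟨F, hF, hFF, hFF', hFP, r, hr⟩ := exists_partialIsometry hW hW' e
  set P := projMat W with hP
  have hPP : P * P = P := projMat_mul_self W
  have hPs : star P = P := star_projMat W
  have hPF : P * F = (r : ℂ) • P := by rw [← hr, mul_assoc, hFP]
  have hFsP : star F * P = (r : ℂ) • P := by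
    have := congrArg star hPF
    rwa [star_mul, hPs, star_smul, hPs, RCLike.star_def, Complex.conj_ofReal] at this
  have hDD : star (P - F) * (P - F) = (2 * (1 - (r : ℂ))) • P := by
    rw [star_sub, hPs, sub_mul, mul_sub, mul_sub, hPP, hPF, hFsP, hFF]
    module
  by_cases h1 : r = 1
  · have hPF' : P - F = 0 := by
      rw [← Matrix.conjTranspose_mul_self_eq_zero, ← Matrix.star_eq_conjTranspose, hDD, h1]
      simp
    refine ⟨1, one_mem _, ?_⟩
    rw [← hFF', ← sub_eq_zero.mp hPF', hPs, hPP]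
    simp
  · have h1' : 1 - (r : ℂ) ≠ 0 := by
      rw [sub_ne_zero]; exact_mod_cast Ne.symm h1
    let D := P - F
    let s : ℂ := (1 - (r : ℂ))⁻¹
    have hs : star s = s := by simp [s]
    let R : Matrix X X ℂ := 1 - s • (D * star D)
    have hRs : star R = R := by
      simp only [R, star_sub, star_one, star_smul, star_mul, star_star, hs]
    have hDP : D * P = D := by simp only [D, sub_mul, hPP, hFP]
    have hDDD : (D * star D) * (D * star D) = (2 * (1 - (r : ℂ))) • (D * star D) := by
      rw [mul_assoc, ← mul_assoc (star D), hDD, smul_mul_assoc, mul_smul_comm, ← mul_assoc, hDP]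
    have hRR : R * R = 1 := by
      have hss : s * s * (2 * (1 - (r : ℂ))) = 2 * s := by
        simp only [s]; field_simp
      show (1 - s • (D * star D)) * (1 - s • (D * star D)) = 1
      rw [sub_mul, one_mul, mul_sub, mul_one, smul_mul_smul_comm, hDDD, smul_smul, hss]
      module
    have hDsP : star D * P = (1 - (r : ℂ)) • P := by
      simp only [D, star_sub, hPs, sub_mul, hPP, hFsP]
      module
    have hRP : R * P = F := by
      simp only [R, sub_mul, one_mul, smul_mul_assoc, mul_assoc, hDsP, mul_smul_comm, hDP,
        smul_smul]
      rw [show s * (1 - (r : ℂ)) = 1 from inv_mul_cancel₀ h1', one_smul]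
      simp [D]
    have hD : D ∈ commutant U := sub_mem (projMat_mem_commutant W) hF
    refine ⟨⟨R, Matrix.mem_unitaryGroup_iff.mpr (by rw [hRs, hRR])⟩,
      sub_mem (one_mem _) (Subalgebra.smul_mem _ (mul_mem hD (star_mem_commutant hD)) s), ?_⟩
    calc R * P * star R = (R * P) * star (R * P) := by
          rw [star_mul, hPs, ← mul_assoc, mul_assoc R P P, hPP]
      _ = projMat W' := by rw [hRP, hFF']

/-- Induction over the invariant projections commuting with an invariant unitary `V`, peeling off
one irreducible subrepresentation inside an eigenspace of `V` at a time. -/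
theorem projection_induction (V : Matrix.unitaryGroup X ℂ) (hV : V.1 ∈ commutant U)
    {motive : Matrix X X ℂ → Prop} (zero : motive 0)
    (step : ∀ (Q : Matrix X X ℂ) (W : Subrepresentation (matRep U)) (z : Circle),
      W.toRepresentation.IsIrreducible → star Q = Q → Q * projMat W = projMat W →
      V.1 * projMat W = (z : ℂ) • projMat W →
      motive (Q - projMat W) → motive Q) : motive 1 := by
  suffices h : ∀ Q : Matrix X X ℂ, IsStarProjection Q → Q ∈ commutant U → V.1 * Q = Q * V.1 →
      motive Q from h 1 (.one _) (one_mem _) (by simp)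
  intro Q
  induction h : Module.finrank ℂ (LinearMap.range (Matrix.toLin' Q)) using
    Nat.strong_induction_on generalizing Q with
  | _ m ih =>
  intro hQ hQc hVQ
  by_cases hQ0 : Q = 0
  · rwa [hQ0]
  have hQQ : Q * Q = Q := hQ.isIdempotentElem
  have hrange (x : X → ℂ) : x ∈ LinearMap.range (Matrix.toLin' Q) ↔ Q *ᵥ x = x := by
    constructor
    · rintro ⟨y, rfl⟩
      rw [Matrix.toLin'_apply, Matrix.mulVec_mulVec, hQQ]
    · exact fun hx => ⟨x, hx⟩
  have hVr : ∀ x ∈ LinearMap.range (Matrix.toLin' Q),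
      Matrix.toLin' V.1 x ∈ LinearMap.range (Matrix.toLin' Q) := by
    intro x hx
    rw [hrange] at hx ⊢
    rw [Matrix.toLin'_apply, Matrix.mulVec_mulVec, ← hVQ, ← Matrix.mulVec_mulVec, hx]
  have hnt : Nontrivial (LinearMap.range (Matrix.toLin' Q)) := by
    rw [Submodule.nontrivial_iff_ne_bot, Ne, LinearMap.range_eq_bot]
    simpa using hQ0
  obtain ⟨z, hz⟩ := Module.End.exists_eigenvalue ((Matrix.toLin' V.1).restrict hVr)
  obtain ⟨v, hv⟩ := hz.exists_hasEigenvector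
  have hVv : V.1 *ᵥ v.1 = z • v.1 := congrArg Subtype.val hv.apply_eq_smul
  have hv0 : v.1 ≠ 0 := fun h0 => hv.2 (Subtype.ext h0)
  have hVV : star V.1 * V.1 = 1 := Matrix.mem_unitaryGroup_iff'.mp V.2
  have hz1 : star z * z = 1 := by
    have h1 : star (V.1 *ᵥ v.1) ⬝ᵥ (V.1 *ᵥ v.1) = star v.1 ⬝ᵥ v.1 := by
      rw [Matrix.star_mulVec, ← Matrix.dotProduct_mulVec, Matrix.mulVec_mulVec,
        ← Matrix.star_eq_conjTranspose, hVV, Matrix.one_mulVec]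
    rw [hVv, star_smul, smul_dotProduct, dotProduct_smul, smul_smul, smul_eq_mul,
      star_dotProduct_self] at h1
    exact mul_right_cancel₀ (b := ((∑ i, ‖v.1 i‖ ^ 2 : ℝ) : ℂ))
      (by exact_mod_cast (sum_norm_sq_pos hv0).ne') (by rw [h1, one_mul])
  have hzn : ‖z‖ = 1 := by
    have h1 := congrArg norm hz1
    rw [norm_mul, norm_star, norm_one] at h1
    nlinarith [norm_nonneg z]
  obtain ⟨z, rfl⟩ : ∃ w : Circle, (w : ℂ) = z := ⟨⟨z, mem_sphere_zero_iff_norm.mpr hzn⟩, rfl⟩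
  rw [mem_commutant] at hV
  have hQc' := mem_commutant.mp hQc
  let T : Subrepresentation (matRep U) :=
    { toSubmodule := LinearMap.range (Matrix.toLin' Q) ⊓
        Module.End.eigenspace (Matrix.toLin' V.1) (z : ℂ)
      apply_mem_toSubmodule := by
        rintro g x ⟨hx1, hx2⟩
        rw [SetLike.mem_coe, hrange] at hx1
        rw [SetLike.mem_coe, Module.End.mem_eigenspace_iff, Matrix.toLin'_apply] at hx2
        refine ⟨?_, ?_⟩
        · rw [SetLike.mem_coe, hrange, matRep_apply, Matrix.mulVec_mulVec, ← hQc',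
            ← Matrix.mulVec_mulVec, hx1]
        · rw [SetLike.mem_coe, Module.End.mem_eigenspace_iff, Matrix.toLin'_apply, matRep_apply,
            Matrix.mulVec_mulVec, ← hV, ← Matrix.mulVec_mulVec, hx2, Matrix.mulVec_smul] }
  have hT : T.toSubmodule ≠ ⊥ := by
    rw [Submodule.ne_bot_iff]
    exact ⟨v.1, ⟨v.2, Module.End.mem_eigenspace_iff.mpr hVv⟩, hv0⟩
  obtain ⟨W, hW, hWT⟩ := exists_irreducible_le hT
  have hQP : Q * projMat W = projMat W := by
    refine Matrix.ext_of_mulVec_single fun i => ?_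
    rw [← Matrix.mulVec_mulVec]
    exact (hrange _).mp (hWT (projMat_mulVec_mem W _)).1
  have hVP : V.1 * projMat W = (z : ℂ) • projMat W := by
    refine Matrix.ext_of_mulVec_single fun i => ?_
    rw [← Matrix.mulVec_mulVec, Matrix.smul_mulVec]
    exact Module.End.mem_eigenspace_iff.mp (hWT (projMat_mulVec_mem W _)).2
  have hPV : projMat W * V.1 = (z : ℂ) • projMat W := by
    have h1 : projMat W = (z : ℂ) • (star V.1 * projMat W) := by
      rw [← mul_smul_comm, ← hVP, ← mul_assoc, hVV, one_mul]
    have h2 := congrArg star h1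
    rw [star_smul, star_mul, star_star, star_projMat] at h2
    rw [h2, smul_smul, mul_comm (z : ℂ), hz1, one_smul, ← h2]
  have hPQ : projMat W * Q = projMat W := by
    have := congrArg star hQP
    rwa [star_mul, star_projMat, hQ.isSelfAdjoint] at this
  have hQ' : IsStarProjection (Q - projMat W) := by
    refine ⟨?_, ?_⟩
    · show (Q - projMat W) * (Q - projMat W) = _
      rw [sub_mul, mul_sub, mul_sub, hQQ, hQP, hPQ, projMat_mul_self]
      simp
    · show star (Q - projMat W) = _
      rw [star_sub, star_projMat, hQ.isSelfAdjoint]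
  refine step Q W z hW hQ.isSelfAdjoint hQP hVP (ih _ ?_ (Q - projMat W) rfl hQ'
    (sub_mem hQc (projMat_mem_commutant W)) ?_)
  · rw [← h]
    refine Submodule.finrank_lt_finrank_of_lt (lt_of_le_of_ne ?_ fun heq => ?_)
    · rintro _ ⟨y, rfl⟩
      rw [hrange, Matrix.toLin'_apply, Matrix.mulVec_mulVec, mul_sub, hQQ, hQP]
    · obtain ⟨w, hw, hw0⟩ := exists_ne_zero_of_isIrreducible hW
      have h1 : w ∈ LinearMap.range (Matrix.toLin' (Q - projMat W)) := heq.ge (hWT hw).1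
      obtain ⟨y, hy⟩ := h1
      have h2 : (Q - projMat W) *ᵥ w = w := by
        rw [← hy, Matrix.toLin'_apply, Matrix.mulVec_mulVec, hQ'.isIdempotentElem]
      rw [Matrix.sub_mulVec, projMat_mulVec_of_mem hw, (hrange w).mp (hWT hw).1, sub_self] at h2
      exact hw0 h2.symm
  · rw [mul_sub, sub_mul, hVQ, hVP, hPV]

variable (U) in
/-- The space of a unitary representation is an orthogonal sum of irreducible subrepresentations. -/
theorem exists_orthogonal_decomposition :
    ∃ (m : ℕ) (W : Fin m → Subrepresentation (matRep U)),
      (∀ a, (W a).toRepresentation.IsIrreducible) ∧ ∑ a, projMat (W a) = 1 ∧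
      ∀ a b, a ≠ b → projMat (W a) * projMat (W b) = 0 := by
  refine projection_induction (U := U) 1 (one_mem _)
    (motive := fun Q => ∃ (m : ℕ) (W : Fin m → Subrepresentation (matRep U)),
      (∀ a, (W a).toRepresentation.IsIrreducible) ∧ ∑ a, projMat (W a) = Q ∧
      ∀ a b, a ≠ b → projMat (W a) * projMat (W b) = 0)
    ⟨0, Fin.elim0, fun a => a.elim0, by simp, fun a => a.elim0⟩ ?_
  rintro Q T z hT hQ hQT - ⟨m, W, hW, hsum, horth⟩
  have hTQ : projMat T * Q = projMat T := by
    have := congrArg star hQT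
    rwa [star_mul, star_projMat, hQ] at this
  have h1 (a : Fin m) : projMat T * projMat (W a) = 0 := by
    have h2 : (Q - projMat T) * projMat (W a) = projMat (W a) := by
      rw [← hsum, Finset.sum_mul, Finset.sum_eq_single a (fun b _ hb => horth b a hb) (by simp),
        projMat_mul_self]
    rw [← h2, ← mul_assoc, mul_sub, hTQ, projMat_mul_self, sub_self, zero_mul]
  have h2 (a : Fin m) : projMat (W a) * projMat T = 0 := by
    have := congrArg star (h1 a)
    rwa [star_mul, star_projMat, star_projMat, star_zero] at this
  refine ⟨m + 1, Fin.cons T W, ?_, ?_, ?_⟩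
  · intro a
    refine Fin.cases hT (fun b => hW b) a
  · rw [Fin.sum_univ_succ]
    simp [hsum]
  · intro a b
    refine Fin.cases (Fin.cases ?_ (fun b => ?_) b) (fun a => Fin.cases ?_ (fun b => ?_) b) a
    · simp
    · exact fun _ => h1 b
    · exact fun _ => h2 a
    · intro hab
      simpa using horth a b (fun h => hab (by rw [h]))

variable (U) in
/-- The group of all invariant unitaries. -/
def invGroup : Subgroup (Matrix.unitaryGroup X ℂ) where
  carrier := {V | V.1 ∈ commutant U}
  mul_mem' := fun ha hb => (commutant U).mul_mem ha hb
  one_mem' := one_mem (commutant U)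
  inv_mem' := fun ha => star_mem_commutant ha

theorem mem_invGroup {V : Matrix.unitaryGroup X ℂ} : V ∈ invGroup U ↔ V.1 ∈ commutant U := Iff.rfl

/-- The invariant unitaries `1 + (z - 1) P` that multiply the range of an invariant projection `P`
by a phase `z`. -/
def gate {P : Matrix X X ℂ} (hP : IsStarProjection P) (hc : P ∈ commutant U) :
    Circle →* invGroup U where
  toFun z := ⟨⟨1 + ((z : ℂ) - 1) • P, by
    have hz : (z : ℂ) * star (z : ℂ) = 1 := by
      rw [RCLike.star_def, Complex.mul_conj]; simp
    have hPP : P * P = P := hP.isIdempotentElem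
    rw [Matrix.mem_unitaryGroup_iff, star_add, star_smul, star_one, hP.isSelfAdjoint, mul_add,
      add_mul, add_mul, smul_mul_smul_comm, hPP, star_sub, star_one]
    simp only [one_mul, mul_one]
    have : ((z : ℂ) - 1) * (star (z : ℂ) - 1) = 2 - z - star (z : ℂ) := by
      linear_combination hz
    rw [this]
    module⟩, add_mem (one_mem _) (Subalgebra.smul_mem _ hc _)⟩
  map_one' := by refine Subtype.ext (Subtype.ext ?_); simp
  map_mul' z w := by
    have hPP : P * P = P := hP.isIdempotentElem
    refine Subtype.ext (Subtype.ext ?_)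
    show 1 + (((z * w : Circle) : ℂ) - 1) • P = (1 + ((z : ℂ) - 1) • P) * (1 + ((w : ℂ) - 1) • P)
    rw [mul_add, add_mul, add_mul, smul_mul_smul_comm, hPP, Circle.coe_mul]
    simp only [one_mul, mul_one]
    module

/-- The gates that multiply a subrepresentation by a phase. -/
def repGate (W : Subrepresentation (matRep U)) : Circle →* invGroup U :=
  gate (projMat_isStarProjection W) (projMat_mem_commutant W)

theorem repGate_coe (W : Subrepresentation (matRep U)) (z : Circle) :
    (repGate W z).1.1 = 1 + ((z : ℂ) - 1) • projMat W := rfl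

/-- The invariant unitaries are generated by the phase gates of irreducible subrepresentations. -/
theorem invGroup_induction {p : invGroup U → Prop} (one : p 1)
    (mul_gate : ∀ (V : invGroup U) (W : Subrepresentation (matRep U)) (z : Circle),
      W.toRepresentation.IsIrreducible → p V → p (V * repGate W z)) (V : invGroup U) : p V := by
  refine projection_induction V.1 V.2
    (motive := fun Q => ∀ B : invGroup U, B.1.1 = V.1.1 * Q + (1 - Q) → p B) ?_ ?_ V (by simp)
  · intro B hB
    have : B = 1 := by
      refine Subtype.ext (Subtype.ext ?_)
      rw [hB]; simp
    rwa [this]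
  · intro Q W z hW _ hQW hVW ih B hB
    have hBW : B.1.1 * projMat W = (z : ℂ) • projMat W := by
      rw [hB, add_mul, sub_mul, mul_assoc, hQW, hVW]; simp
    have h1 := mul_gate (B * repGate W z⁻¹) W z hW (ih _ ?_)
    · rwa [mul_assoc, ← map_mul, inv_mul_cancel, map_one, mul_one] at h1
    · show B.1.1 * (1 + (((z⁻¹ : Circle) : ℂ) - 1) • projMat W) = _
      have hz : ((z⁻¹ : Circle) : ℂ) * (z : ℂ) = 1 := by
        rw [← Circle.coe_mul, inv_mul_cancel, Circle.coe_one]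
      rw [mul_add, mul_one, mul_smul_comm, hBW, smul_smul, sub_mul, hz, hB, mul_sub, hVW]
      module

/-- Phase gates of equivalent irreducible subrepresentations have the same image under every
homomorphism to a commutative group. -/
theorem map_repGate_eq_of_equiv {C : Type*} [CommGroup C] (φ : invGroup U →* C)
    {W W' : Subrepresentation (matRep U)}
    (hW : W.toRepresentation.IsIrreducible) (hW' : W'.toRepresentation.IsIrreducible)
    (e : W.toRepresentation.Equiv W'.toRepresentation) (z : Circle) :
    φ (repGate W z) = φ (repGate W' z) := by
  obtain ⟨R, hR, hRW⟩ := exists_unitary_conj_projMat hW hW' e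
  have h : repGate W' z = ⟨R, hR⟩ * repGate W z * (⟨R, hR⟩ : invGroup U)⁻¹ := by
    refine Subtype.ext (Subtype.ext ?_)
    show 1 + ((z : ℂ) - 1) • projMat W' = R.1 * (1 + ((z : ℂ) - 1) • projMat W) * star R.1
    rw [mul_add, add_mul, mul_smul_comm, smul_mul_assoc, hRW, mul_one,
      Matrix.mem_unitaryGroup_iff.mp R.2]
  rw [h, map_mul, map_mul, map_inv, mul_right_comm, mul_inv_cancel, one_mul]

end Commutant

/-! ### Action of the commutant on the multiplicity spaces -/

section Idempotent

variable {M : Type*} [AddCommGroup M] [Module ℂ M] [FiniteDimensional ℂ M]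

theorem trace_of_isIdempotentElem {E : Module.End ℂ M} (hE : IsIdempotentElem E) :
    LinearMap.trace ℂ M E = Module.finrank ℂ (LinearMap.range E) :=
  (LinearMap.IsIdempotentElem.isProj_range E hE).trace

theorem det_one_add_smul_of_isIdempotentElem {E : Module.End ℂ M} (hE : IsIdempotentElem E)
    (z : ℂ) : LinearMap.det (1 + (z - 1) • E) = z ^ Module.finrank ℂ (LinearMap.range E) := by
  have hp := LinearMap.IsIdempotentElem.isProj_range E hE
  let e := Submodule.prodEquivOfIsCompl _ _ hp.isCompl
  have h1 : 1 + (z - 1) • E = e.conj (LinearMap.prodMap (z • LinearMap.id) LinearMap.id) := by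
    conv_lhs => rw [hp.eq_conj_prodMap]
    have h2 : (1 : Module.End ℂ M) = e.conj (LinearMap.prodMap LinearMap.id LinearMap.id) := by
      rw [LinearMap.prodMap_id, LinearEquiv.conj_id]; rfl
    rw [h2, ← map_smul, ← map_add]
    congr 1
    ext
    · simp; module
    all_goals simp
  rw [h1, LinearEquiv.conj_apply, LinearMap.comp_assoc, LinearMap.det_conj, LinearMap.det_prodMap,
    LinearMap.det_smul]
  simp

end Idempotent

section IrrepClass

variable {G H : Type*} [Group G] [AddCommGroup H] [Module ℂ H]

/-- The class of an irreducible subrepresentation. -/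
def irrepClass {ρ : Representation ℂ G H} (W : Subrepresentation ρ)
    (hW : W.toRepresentation.IsIrreducible) : Irreps ρ :=
  Quotient.mk (irrepSetoid ρ) ⟨W, hW⟩

theorem Irreps.rep_isIrreducible {ρ : Representation ℂ G H} (l : Irreps ρ) :
    l.rep.toRepresentation.IsIrreducible := (Quotient.out l).2

theorem irrepClass_eq_iff {ρ : Representation ℂ G H} {W : Subrepresentation ρ}
    {hW : W.toRepresentation.IsIrreducible} {l : Irreps ρ} :
    irrepClass W hW = l ↔ Nonempty (W.toRepresentation.Equiv l.rep.toRepresentation) := by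
  constructor
  · intro h
    rw [← Quotient.out_eq l] at h
    exact Quotient.exact h
  · intro h
    rw [← Quotient.out_eq l]
    exact Quotient.sound h

theorem irrepClass_rep {ρ : Representation ℂ G H} (l : Irreps ρ) :
    irrepClass l.rep l.rep_isIrreducible = l := Quotient.out_eq l

end IrrepClass

section Blocks

variable {X : Type*} [Fintype X] [DecidableEq X] {G : Type*} [Group G]
variable {U : G →* Matrix.unitaryGroup X ℂ}

/-- The action of the commutant by composition on the multiplicity space `Hom_G(σ, ℂ^X)`. -/
def blockHom {V : Type*} [AddCommGroup V] [Module ℂ V] (σ : Representation ℂ G V) :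
    commutant U →ₐ[ℂ] Module.End ℂ (σ.IntertwiningMap (matRep U)) where
  toFun A :=
    { toFun f := ⟨Matrix.toLin' A.1 ∘ₗ f.toLinearMap, fun g => by
        ext1 v
        show A.1 *ᵥ f (σ g v) = (U g : Matrix X X ℂ) *ᵥ (A.1 *ᵥ f v)
        rw [f.isIntertwining, matRep_apply, Matrix.mulVec_mulVec, Matrix.mulVec_mulVec,
          mem_commutant.mp A.2]⟩
      map_add' f f' := by
        ext1; exact LinearMap.comp_add _ _ _
      map_smul' c f := by
        ext1; exact LinearMap.comp_smul _ _ _ }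
  map_one' := by ext f v; simp
  map_mul' A B := by ext f v; simp
  map_zero' := by ext f v; simp
  map_add' A B := by ext f v; simp
  commutes' c := by ext f v; simp [Algebra.algebraMap_eq_smul_one]

theorem blockHom_apply {V : Type*} [AddCommGroup V] [Module ℂ V] (σ : Representation ℂ G V)
    (A : commutant U) (f : σ.IntertwiningMap (matRep U)) (v : V) :
    blockHom σ A f v = A.1 *ᵥ f v := rfl

/-- The rank of an operator in the commutant on the multiplicity space `Hom_G(σ, ℂ^X)`. For an
irreducible `σ` and an invariant projection, this is the multiplicity of `σ` in its range. -/
def blockRank {V : Type*} [AddCommGroup V] [Module ℂ V] (σ : Representation ℂ G V)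
    (A : commutant U) : ℕ :=
  Module.finrank ℂ (LinearMap.range (blockHom σ A))

theorem blockRank_one (l : Irreps (matRep U)) :
    blockRank l.rep.toRepresentation (1 : commutant U) = l.mult := by
  rw [blockRank, map_one, Module.End.one_eq_id, LinearMap.range_id, finrank_top]
  rfl

theorem isIdempotentElem_blockHom {V : Type*} [AddCommGroup V] [Module ℂ V]
    (σ : Representation ℂ G V) {A : commutant U} (hA : IsIdempotentElem A.1) :
    IsIdempotentElem (blockHom σ A) := by
  have : IsIdempotentElem A := Subtype.ext hA
  exact this.map (blockHom σ)

theorem blockRank_cast {V : Type*} [AddCommGroup V] [Module ℂ V] [FiniteDimensional ℂ V]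
    (σ : Representation ℂ G V) {A : commutant U} (hA : IsIdempotentElem A.1) :
    (blockRank σ A : ℂ) = LinearMap.trace ℂ _ (blockHom σ A) :=
  (trace_of_isIdempotentElem (isIdempotentElem_blockHom σ hA)).symm

/-- An intertwiner followed by the orthogonal projection onto a subrepresentation. -/
def compressMap {V : Type*} [AddCommGroup V] [Module ℂ V] {σ : Representation ℂ G V}
    (W : Subrepresentation (matRep U)) (f : σ.IntertwiningMap (matRep U)) :
    σ.IntertwiningMap W.toRepresentation :=
  ⟨(Matrix.toLin' (projMat W) ∘ₗ f.toLinearMap).codRestrict W.toSubmodule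
    (fun _ => projMat_mulVec_mem W _), fun g => by
      ext1 v
      apply Subtype.ext
      show projMat W *ᵥ f (σ g v) = (U g : Matrix X X ℂ) *ᵥ (projMat W *ᵥ f v)
      rw [f.isIntertwining, matRep_apply, Matrix.mulVec_mulVec, Matrix.mulVec_mulVec,
        mem_commutant.mp (projMat_mem_commutant W)]⟩

open scoped Classical in
/-- By Schur's lemma, an irreducible subrepresentation contains its own class once and no other
class. -/
theorem blockRank_projMat (l : Irreps (matRep U)) (W : Subrepresentation (matRep U))
    (hW : W.toRepresentation.IsIrreducible) :
    blockRank l.rep.toRepresentation ⟨projMat W, projMat_mem_commutant W⟩ =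
      if irrepClass W hW = l then 1 else 0 := by
  have hl := l.rep_isIrreducible
  split_ifs with h
  · obtain ⟨e⟩ := irrepClass_eq_iff.mp h
    let j : l.rep.toRepresentation.IntertwiningMap (matRep U) :=
      ⟨W.toSubmodule.subtype ∘ₗ e.symm.toIntertwiningMap.toLinearMap, fun g => by
        ext1 v
        show (e.symm.toIntertwiningMap (l.rep.toRepresentation g v)).1 =
          (W.toRepresentation g (e.symm.toIntertwiningMap v)).1
        rw [Representation.IntertwiningMap.isIntertwining]⟩
    have hj (v) : j v = (e.symm v).1 := rfl
    have hjr : blockHom l.rep.toRepresentation ⟨projMat W, projMat_mem_commutant W⟩ j = j := by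
      refine DFunLike.ext _ _ fun v => ?_
      rw [blockHom_apply]
      exact projMat_mulVec_of_mem (e.symm v).2
    refine finrank_eq_one (⟨j, j, hjr⟩ : LinearMap.range (blockHom l.rep.toRepresentation
      (⟨projMat W, projMat_mem_commutant W⟩ : commutant U))) ?_ ?_
    · intro h0
      obtain ⟨x, hx, hx0⟩ := exists_ne_zero_of_isIrreducible hW
      have h1 : j (e ⟨x, hx⟩) = 0 := by
        have h2 : j = 0 := congrArg Subtype.val h0
        rw [h2]; rfl
      rw [hj, Representation.Equiv.symm_apply_apply] at h1
      exact hx0 h1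
    · rintro ⟨_, f, rfl⟩
      obtain ⟨c, hc⟩ :=
        Representation.IsIrreducible.algebraMap_intertwiningMap_bijective_of_isAlgClosed.2
          (e.toIntertwiningMap.comp (compressMap W f))
      refine ⟨c, Subtype.ext (DFunLike.ext _ _ fun v => ?_)⟩
      have h1 : e (compressMap W f v) = c • v :=
        (congrArg (fun F => F v) hc).symm
      have h2 : compressMap W f v = c • e.symm v := by
        rw [← map_smul, ← h1, Representation.Equiv.symm_apply_apply]
      exact (congrArg Subtype.val h2).symm
  · rw [blockRank, Submodule.finrank_eq_zero, LinearMap.range_eq_bot]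
    refine LinearMap.ext fun f => DFunLike.ext _ _ fun v => ?_
    rcases Representation.IsIrreducible.bijective_or_eq_zero (compressMap W f) with hb | h0
    · exact absurd
        (irrepClass_eq_iff.mpr ⟨(Representation.IntertwiningMap.ofBijective _ hb).symm⟩) h
    · exact congrArg (fun F => (F v).1) h0

/-- The determinant of an invariant unitary on the multiplicity space of the class `l`. -/
def blockDet (l : Irreps (matRep U)) : invGroup U →* ℂ where
  toFun V := LinearMap.det (blockHom l.rep.toRepresentation ⟨V.1.1, V.2⟩)
  map_one' := by
    have : (⟨(1 : invGroup U).1.1, (1 : invGroup U).2⟩ : commutant U) = 1 := rfl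
    rw [this, map_one, map_one]
  map_mul' V V' := by
    have : (⟨(V * V').1.1, (V * V').2⟩ : commutant U) = ⟨V.1.1, V.2⟩ * ⟨V'.1.1, V'.2⟩ := rfl
    rw [this, map_mul, map_mul]

/-- On the multiplicity space a projection acts as an idempotent of rank `blockRank`, so a phase
gate acts as a diagonalizable operator with that many eigenvalues `z`, and `1` otherwise. -/
theorem blockDet_gate (l : Irreps (matRep U)) {P : Matrix X X ℂ} (hP : IsStarProjection P)
    (hc : P ∈ commutant U) (z : Circle) :
    blockDet l (gate hP hc z) = (z : ℂ) ^ blockRank l.rep.toRepresentation ⟨P, hc⟩ := by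
  rw [blockRank, ← det_one_add_smul_of_isIdempotentElem
    (isIdempotentElem_blockHom _ (A := ⟨P, hc⟩) hP.isIdempotentElem), ← map_smul,
    ← map_one (blockHom _), ← map_add]
  rfl

theorem norm_blockDet (l : Irreps (matRep U)) (V : invGroup U) : ‖blockDet l V‖ = 1 := by
  induction V using invGroup_induction with
  | one => simp
  | mul_gate V W z hW h =>
    rw [map_mul, norm_mul, h, repGate, blockDet_gate]
    rw [norm_pow, Circle.norm_coe, one_pow, one_mul]

/-- The determinant of an invariant unitary on the multiplicity space of the class `l`, as an
element of the unit circle. -/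
def phase (l : Irreps (matRep U)) : invGroup U →* Circle where
  toFun V := ⟨blockDet l V, mem_sphere_zero_iff_norm.mpr (norm_blockDet l V)⟩
  map_one' := Circle.ext (map_one _)
  map_mul' V V' := Circle.ext (map_mul _ V V')

theorem phase_coe (l : Irreps (matRep U)) (V : invGroup U) : (phase l V : ℂ) = blockDet l V := rfl

theorem phase_gate (l : Irreps (matRep U)) {P : Matrix X X ℂ} (hP : IsStarProjection P)
    (hc : P ∈ commutant U) (z : Circle) :
    phase l (gate hP hc z) = z ^ blockRank l.rep.toRepresentation ⟨P, hc⟩ :=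
  Circle.ext (by rw [phase_coe, blockDet_gate, Circle.coe_pow])

open scoped Classical in
theorem phase_repGate (l : Irreps (matRep U)) {W : Subrepresentation (matRep U)}
    (hW : W.toRepresentation.IsIrreducible) (z : Circle) :
    phase l (repGate W z) = if irrepClass W hW = l then z else 1 := by
  rw [repGate, phase_gate, blockRank_projMat l W hW]
  split_ifs <;> simp

/-- Every homomorphism from the group of invariant unitaries to a commutative group factors through
the determinants on the multiplicity spaces. -/
theorem map_eq_prod_repGate_phase {C : Type*} [CommGroup C] (φ : invGroup U →* C)
    (V : invGroup U) : φ V = ∏ l : Irreps (matRep U), φ (repGate l.rep (phase l V)) := by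
  classical
  induction V using invGroup_induction with
  | one => simp
  | mul_gate V W z hW h =>
    simp only [map_mul, Finset.prod_mul_distrib, ← h]
    congr 1
    rw [Finset.prod_eq_single (irrepClass W hW)]
    · rw [phase_repGate _ hW, if_pos rfl]
      obtain ⟨e⟩ := irrepClass_eq_iff.mp (rfl : irrepClass W hW = irrepClass W hW)
      exact map_repGate_eq_of_equiv φ hW (Irreps.rep_isIrreducible _) e z
    · intro l _ hl
      rw [phase_repGate _ hW, if_neg (Ne.symm hl), map_one, map_one]
    · simp

/-- An invariant unitary whose determinants on all multiplicity spaces are `1` is a product of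
commutators. -/
theorem mem_commutator_of_phase_eq_one {V : invGroup U} (h : ∀ l, phase l V = 1) :
    V ∈ commutator (invGroup U) := by
  rw [← Abelianization.ker_of, MonoidHom.mem_ker, map_eq_prod_repGate_phase]
  simp [h]

end Blocks

/-! ### Multiplicities as averages of characters -/

section Average

variable {Ω : Type*} [TopologicalSpace Ω] [CompactSpace Ω] [MeasurableSpace Ω]
  [OpensMeasurableSpace Ω] {μ : Measure Ω} [IsFiniteMeasure μ]

theorem integrable_of_continuous {f : Ω → ℂ} (hf : Continuous f) : Integrable f μ := by
  obtain ⟨C, hC⟩ := (isCompact_range hf).isBounded.exists_norm_le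
  exact Integrable.of_bound hf.aestronglyMeasurable C
    (Filter.Eventually.of_forall fun x => hC _ ⟨x, rfl⟩)

/-- The entrywise integral of a matrix-valued function. -/
def intMat {Ω : Type*} [MeasurableSpace Ω] {I J : Type*} (μ : Measure Ω) (M : Ω → Matrix I J ℂ) :
    Matrix I J ℂ :=
  Matrix.of fun i j => ∫ x, M x i j ∂μ

theorem intMat_smul {Ω : Type*} [MeasurableSpace Ω] {I J : Type*} {μ : Measure Ω}
    {M : Ω → Matrix I J ℂ} (c : ℂ) : intMat μ (fun x => c • M x) = c • intMat μ M := by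
  ext i j
  exact integral_const_mul c _

theorem intMat_const {Ω : Type*} [MeasurableSpace Ω] {I J : Type*} {μ : Measure Ω}
    [IsProbabilityMeasure μ] (A : Matrix I J ℂ) : intMat μ (fun _ => A) = A := by
  ext i j
  simp [intMat]

variable {I J K : Type*} {M : Ω → Matrix I J ℂ}

theorem integrable_entry (hM : Continuous M) (i : I) (j : J) : Integrable (fun x => M x i j) μ :=
  integrable_of_continuous (hM.matrix_elem i j)

theorem intMat_mul_left [Fintype I] (A : Matrix K I ℂ) (hM : Continuous M) :
    intMat μ (fun x => A * M x) = A * intMat μ M := by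
  ext k j
  simp only [intMat, Matrix.of_apply, Matrix.mul_apply]
  rw [integral_finsetSum _ fun i _ => (integrable_entry hM i j).const_mul _]
  simp only [integral_const_mul]

theorem intMat_mul_right [Fintype J] (B : Matrix J K ℂ) (hM : Continuous M) :
    intMat μ (fun x => M x * B) = intMat μ M * B := by
  ext i k
  simp only [intMat, Matrix.of_apply, Matrix.mul_apply]
  rw [integral_finsetSum _ fun j _ => (integrable_entry hM i j).mul_const _]
  simp only [integral_mul_const]

theorem intMat_add {M' : Ω → Matrix I J ℂ} (hM : Continuous M) (hM' : Continuous M') :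
    intMat μ (fun x => M x + M' x) = intMat μ M + intMat μ M' := by
  ext i j
  exact integral_add (integrable_entry hM i j) (integrable_entry hM' i j)

end Average

section Character

variable {X : Type*} [Fintype X] [DecidableEq X] {G : Type*} [Group G]
variable {U : G →* Matrix.unitaryGroup X ℂ}

theorem character_eq_trace (W : Subrepresentation (matRep U)) (g : G) :
    W.toRepresentation.character g = (projMat W * (U g : Matrix X X ℂ)).trace := by
  have hmem : ∀ x, Matrix.toLin' ((U g : Matrix X X ℂ) * projMat W) x ∈ W.toSubmodule := by
    intro x
    rw [Matrix.toLin'_apply, ← Matrix.mulVec_mulVec]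
    exact W.apply_mem_toSubmodule g (projMat_mulVec_mem W x)
  have h := LinearMap.trace_restrict_eq_of_forall_mem _ _ hmem
  rw [Matrix.trace_toLin'_eq, Matrix.trace_mul_comm] at h
  rw [← h, Representation.character]
  congr 1
  ext1 x
  apply Subtype.ext
  show (U g : Matrix X X ℂ) *ᵥ x.1 = ((U g : Matrix X X ℂ) * projMat W) *ᵥ x.1
  rw [← Matrix.mulVec_mulVec, projMat_mulVec_of_mem x.2]

variable [TopologicalSpace G] [IsTopologicalGroup G] [CompactSpace G] [MeasurableSpace G]
  [BorelSpace G] {μ : Measure G} [IsProbabilityMeasure μ] [μ.IsMulLeftInvariant]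

theorem trace_eq_sum_single (Φ : Matrix X X ℂ →ₗ[ℂ] Matrix X X ℂ) :
    LinearMap.trace ℂ _ Φ = ∑ i, ∑ j, Φ (Matrix.single i j 1) i j := by
  rw [LinearMap.trace_eq_matrix_trace ℂ (Matrix.stdBasis ℂ X X), Matrix.trace,
    Fintype.sum_prod_type]
  refine Finset.sum_congr rfl fun i _ => Finset.sum_congr rfl fun j _ => ?_
  rw [Matrix.diag_apply, LinearMap.toMatrix_apply, Matrix.stdBasis_eq_single]
  rfl

/-- The multiplicity of a subrepresentation `W` in the range of an invariant projection `P`, as an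
integral of characters. The average of `F ↦ P U(g) F U(g)⁻¹ P_W` over the group acts on all
matrices, has its range in the intertwiners from `W`, and acts there as left multiplication by `P`;
so both operators have the same trace. -/
theorem blockRank_eq_integral (hU : Continuous U) (W : Subrepresentation (matRep U))
    {P : Matrix X X ℂ} (hP : IsIdempotentElem P) (hc : P ∈ commutant U) :
    (blockRank W.toRepresentation ⟨P, hc⟩ : ℂ) =
      ∫ g, (P * (U g : Matrix X X ℂ)).trace * star (W.toRepresentation.character g) ∂μ := by
  have hU' : Continuous fun g => (U g : Matrix X X ℂ) := continuous_subtype_val.comp hU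
  set Q := projMat W with hQ
  have hQc (g : G) : (U g : Matrix X X ℂ) * Q = Q * (U g : Matrix X X ℂ) :=
    mem_commutant.mp (projMat_mem_commutant W) g
  have hUU (g : G) : (U g : Matrix X X ℂ) * star (U g : Matrix X X ℂ) = 1 :=
    Matrix.mem_unitaryGroup_iff.mp (U g).2
  let k (F : Matrix X X ℂ) (g : G) : Matrix X X ℂ :=
    P * (U g : Matrix X X ℂ) * F * (star (U g : Matrix X X ℂ) * Q)
  have hk (F : Matrix X X ℂ) : Continuous (k F) := by
    have := hU'.star
    fun_prop
  let Φ : Matrix X X ℂ →ₗ[ℂ] Matrix X X ℂ :=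
    { toFun F := intMat μ (k F)
      map_add' F F' := by
        rw [← intMat_add (hk F) (hk F')]
        simp only [k, mul_add, add_mul]
      map_smul' c F := by
        rw [RingHom.id_apply, ← intMat_smul]
        simp only [k, mul_smul_comm, smul_mul_assoc] }
  have hΦ (F : Matrix X X ℂ) : Φ F = intMat μ (k F) := rfl
  have hΦQ (F : Matrix X X ℂ) : Φ F * Q = Φ F := by
    rw [hΦ, ← intMat_mul_right _ (hk F)]
    simp only [k, mul_assoc, hQ, projMat_mul_self]
  have hΦc (F : Matrix X X ℂ) : Φ F ∈ commutant U := by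
    rw [mem_commutant]
    intro h
    rw [hΦ, ← intMat_mul_left _ (hk F), ← intMat_mul_right _ (hk F)]
    ext i j
    simp only [intMat, Matrix.of_apply]
    -- translating the variable of the average turns `U(h) (Φ F)` into `(Φ F) U(h)`
    rw [← integral_mul_left_eq_self _ h⁻¹]
    congr 1
    ext g
    have h1 : (U h : Matrix X X ℂ) * (U (h⁻¹ * g) : Matrix X X ℂ) = (U g : Matrix X X ℂ) := by
      rw [← Submonoid.coe_mul, ← map_mul, mul_inv_cancel_left]
    have h2 : star (U (h⁻¹ * g) : Matrix X X ℂ) = star (U g : Matrix X X ℂ) * U h := by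
      rw [star_coe_eq_inv, star_coe_eq_inv, mul_inv_rev, inv_inv, map_mul]
      rfl
    have h3 : (U h : Matrix X X ℂ) * k F (h⁻¹ * g) = k F g * (U h : Matrix X X ℂ) := by
      simp only [k]
      rw [h2]
      calc _ = ((U h : Matrix X X ℂ) * P) * (U (h⁻¹ * g) : Matrix X X ℂ) * F *
            (star (U g : Matrix X X ℂ) * (U h : Matrix X X ℂ) * Q) := by simp only [mul_assoc]
        _ = P * ((U h : Matrix X X ℂ) * (U (h⁻¹ * g) : Matrix X X ℂ)) * F *
            (star (U g : Matrix X X ℂ) * ((U h : Matrix X X ℂ) * Q)) := by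
          rw [mem_commutant.mp hc h]; simp only [mul_assoc]
        _ = _ := by rw [h1, hQc]; simp only [mul_assoc]
    exact congrFun (congrFun h3 i) j
  let p : (X → ℂ) →ₗ[ℂ] W.toSubmodule :=
    (Matrix.toLin' Q).codRestrict W.toSubmodule (projMat_mulVec_mem W)
  have hp (x : W.toSubmodule) : p x.1 = x := Subtype.ext (projMat_mulVec_of_mem x.2)
  -- `ι` extends an intertwiner from `W` by zero, and `Ψ` restricts an average to `W`
  let ι : W.toRepresentation.IntertwiningMap (matRep U) →ₗ[ℂ] Matrix X X ℂ :=
    { toFun f := LinearMap.toMatrix' (f.toLinearMap ∘ₗ p)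
      map_add' f f' := by
        rw [← map_add]; rfl
      map_smul' c f := by
        rw [RingHom.id_apply, ← map_smul]; rfl }
  have hι (f : W.toRepresentation.IntertwiningMap (matRep U)) (x : X → ℂ) :
      ι f *ᵥ x = f (p x) := by
    rw [← Matrix.toLin'_apply]
    exact congrArg (fun F => F x) (Matrix.toLin'_toMatrix' (f.toLinearMap ∘ₗ p))
  have hιc (f : W.toRepresentation.IntertwiningMap (matRep U)) : ι f ∈ commutant U := by
    rw [mem_commutant]
    intro g
    refine Matrix.ext_of_mulVec_single fun i => ?_
    rw [← Matrix.mulVec_mulVec, ← Matrix.mulVec_mulVec, hι, hι]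
    have h1 : p ((U g : Matrix X X ℂ) *ᵥ Pi.single i 1) =
        W.toRepresentation g (p (Pi.single i 1)) := by
      apply Subtype.ext
      show Q *ᵥ ((U g : Matrix X X ℂ) *ᵥ Pi.single i 1) =
        (U g : Matrix X X ℂ) *ᵥ (Q *ᵥ Pi.single i 1)
      rw [Matrix.mulVec_mulVec, Matrix.mulVec_mulVec, hQc]
    rw [h1, f.isIntertwining]
    rfl
  let Ψ : Matrix X X ℂ →ₗ[ℂ] W.toRepresentation.IntertwiningMap (matRep U) :=
    { toFun F := ⟨(Matrix.toLin' (Φ F)).domRestrict W.toSubmodule, fun g => by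
        ext1 v
        show Φ F *ᵥ ((U g : Matrix X X ℂ) *ᵥ v.1) = (U g : Matrix X X ℂ) *ᵥ (Φ F *ᵥ v.1)
        rw [Matrix.mulVec_mulVec, Matrix.mulVec_mulVec, mem_commutant.mp (hΦc F)]⟩
      map_add' F F' := by
        refine DFunLike.ext _ _ fun v => ?_
        show Φ (F + F') *ᵥ v.1 = Φ F *ᵥ v.1 + Φ F' *ᵥ v.1
        rw [map_add, Matrix.add_mulVec]
      map_smul' c F := by
        refine DFunLike.ext _ _ fun v => ?_
        show Φ (c • F) *ᵥ v.1 = c • (Φ F *ᵥ v.1)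
        rw [map_smul, Matrix.smul_mulVec] }
  have hιΨ : ι ∘ₗ Ψ = Φ := by
    refine LinearMap.ext fun F => Matrix.ext_of_mulVec_single fun i => ?_
    rw [LinearMap.comp_apply, hι]
    show Φ F *ᵥ (Q *ᵥ Pi.single i 1) = _
    rw [Matrix.mulVec_mulVec, hΦQ]
  have hΨι : Ψ ∘ₗ ι = blockHom W.toRepresentation ⟨P, hc⟩ := by
    refine LinearMap.ext fun f => DFunLike.ext _ _ fun v => ?_
    show Φ (ι f) *ᵥ v.1 = P *ᵥ f v
    have h1 : k (ι f) = fun _ => P * ι f * Q := by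
      funext g
      simp only [k, mul_assoc]
      rw [← mul_assoc (U g : Matrix X X ℂ), mem_commutant.mp (hιc f), mul_assoc (ι f),
        ← mul_assoc (U g : Matrix X X ℂ), hUU, one_mul]
    rw [hΦ, h1, intMat_const, ← Matrix.mulVec_mulVec, projMat_mulVec_of_mem v.2,
      ← Matrix.mulVec_mulVec, hι, hp]
  rw [blockRank_cast _ (A := ⟨P, hc⟩) hP, ← hΨι, LinearMap.trace_comp_comm', hιΨ,
    trace_eq_sum_single]
  have hstar (g : G) : star (W.toRepresentation.character g) =
      (star (U g : Matrix X X ℂ) * Q).trace := by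
    rw [character_eq_trace, ← Matrix.trace_conjTranspose, ← Matrix.star_eq_conjTranspose, star_mul,
      star_projMat]
  have hterm (i j : X) : Φ (Matrix.single i j 1) i j =
      ∫ g, (P * (U g : Matrix X X ℂ)) i i * (star (U g : Matrix X X ℂ) * Q) j j ∂μ := by
    show ∫ g, _ ∂μ = _
    congr 1
    ext g
    simp only [k]
    rw [Matrix.mul_apply, Finset.sum_eq_single j]
    · simp
    · intro b _ hb
      simp [hb]
    · simp
  simp only [hterm, hstar]
  have hint (i j : X) : Integrable (fun g => (P * (U g : Matrix X X ℂ)) i i *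
      (star (U g : Matrix X X ℂ) * Q) j j) μ := by
    refine integrable_of_continuous ?_
    have := hU'.star
    exact ((continuous_const.mul hU').matrix_elem i i).mul
      ((this.mul continuous_const).matrix_elem j j)
  simp only [Matrix.trace, Matrix.diag_apply, Finset.sum_mul_sum]
  rw [integral_finsetSum _ fun i _ => integrable_finsetSum _ fun j _ => hint i j]
  refine Finset.sum_congr rfl fun i _ => ?_
  rw [integral_finsetSum _ fun j _ => hint i j]

end Character

/-! ### Splittings of the qudits -/

section Locality

open scoped Kronecker

variable {d k m n : ℕ}

/-- The decomposition of the standard basis of `n` qudits along a splitting of the qudits. -/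
def splitEquiv (e : Fin k ⊕ Fin m ≃ Fin n) :
    (Fin n → Fin d) ≃ (Fin k → Fin d) × (Fin m → Fin d) :=
  (Equiv.arrowCongr e.symm (Equiv.refl _)).trans (Equiv.sumArrowEquivProdArrow _ _ _)

/-- The operator `A ⊗ B` on `n` qudits that are split into `k` qudits and `m` qudits. -/
def splitKron (e : Fin k ⊕ Fin m ≃ Fin n) (A : Matrix (Fin k → Fin d) (Fin k → Fin d) ℂ)
    (B : Matrix (Fin m → Fin d) (Fin m → Fin d) ℂ) : Matrix (Fin n → Fin d) (Fin n → Fin d) ℂ :=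
  (A ⊗ₖ B).submatrix (splitEquiv e) (splitEquiv e)

variable (e : Fin k ⊕ Fin m ≃ Fin n)

theorem splitKron_mul (A A' : Matrix (Fin k → Fin d) (Fin k → Fin d) ℂ)
    (B B' : Matrix (Fin m → Fin d) (Fin m → Fin d) ℂ) :
    splitKron e A B * splitKron e A' B' = splitKron e (A * A') (B * B') := by
  rw [splitKron, splitKron, splitKron, Matrix.submatrix_mul_equiv, Matrix.mul_kronecker_mul]

theorem splitKron_one : splitKron (d := d) e 1 1 = 1 := by
  rw [splitKron, Matrix.one_kronecker_one, Matrix.submatrix_one_equiv]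

theorem star_splitKron (A : Matrix (Fin k → Fin d) (Fin k → Fin d) ℂ)
    (B : Matrix (Fin m → Fin d) (Fin m → Fin d) ℂ) :
    star (splitKron e A B) = splitKron e (star A) (star B) := by
  rw [splitKron, splitKron, Matrix.star_eq_conjTranspose, Matrix.conjTranspose_submatrix,
    Matrix.conjTranspose_kronecker]
  rfl

theorem trace_splitKron (A : Matrix (Fin k → Fin d) (Fin k → Fin d) ℂ)
    (B : Matrix (Fin m → Fin d) (Fin m → Fin d) ℂ) :
    (splitKron e A B).trace = A.trace * B.trace := by
  rw [← Matrix.trace_kronecker, Matrix.trace, Matrix.trace]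
  exact Equiv.sum_comp (splitEquiv e) fun x => (A ⊗ₖ B) x x

theorem tensorPow_eq_splitKron (A : Matrix (Fin d) (Fin d) ℂ) :
    tensorPow n A = splitKron e (tensorPow k A) (tensorPow m A) := by
  ext x y
  show ∏ i, A (x i) (y i) = (∏ i, A (x (e (.inl i))) (y (e (.inl i)))) *
    ∏ i, A (x (e (.inr i))) (y (e (.inr i)))
  rw [← Equiv.prod_comp e, Fintype.prod_sum_type]

theorem trace_tensorPow (A : Matrix (Fin d) (Fin d) ℂ) : (tensorPow m A).trace = A.trace ^ m := by
  have h := Finset.prod_univ_sum (fun _ : Fin m => (Finset.univ : Finset (Fin d)))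
    (fun _ j => A j j)
  rw [Fintype.piFinset_univ, Finset.prod_const, Finset.card_univ, Fintype.card_fin] at h
  exact h.symm

theorem star_tensorPow {X : Type*} [Fintype X] [DecidableEq X] (A : Matrix X X ℂ) :
    star (tensorPow m A) = tensorPow m (star A) := by
  ext x y
  show star (∏ i, A (y i) (x i)) = ∏ i, star (A (y i) (x i))
  exact map_prod (starRingEnd ℂ) _ _

/-- The operator `A ⊗ 1` on `n` qudits that are split into `k` qudits and `m` qudits. -/
def emb : Matrix (Fin k → Fin d) (Fin k → Fin d) ℂ →ₐ[ℂ]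
    Matrix (Fin n → Fin d) (Fin n → Fin d) ℂ :=
  AlgHom.ofLinearMap
    { toFun A := splitKron e A 1
      map_add' A B := by rw [splitKron, Matrix.add_kronecker]; rfl
      map_smul' c A := by rw [splitKron, Matrix.smul_kronecker]; rfl }
    (splitKron_one e) fun A B => by
      show splitKron e (A * B) 1 = splitKron e A 1 * splitKron e B 1
      rw [splitKron_mul, mul_one]

theorem emb_eq (A : Matrix (Fin k → Fin d) (Fin k → Fin d) ℂ) : emb e A = splitKron e A 1 := rfl

theorem star_emb (A : Matrix (Fin k → Fin d) (Fin k → Fin d) ℂ) :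
    star (emb e A) = emb e (star A) := by
  rw [emb_eq, star_splitKron, star_one, emb_eq]

theorem emb_injective [Nonempty (Fin m → Fin d)] :
    Function.Injective (emb (d := d) e) := by
  intro A B h
  obtain ⟨c⟩ := ‹Nonempty (Fin m → Fin d)›
  ext a b
  have h1 := congrFun (congrFun h ((splitEquiv e).symm (a, c))) ((splitEquiv e).symm (b, c))
  simpa [emb_eq, splitKron] using h1

theorem isStarProjection_emb {P : Matrix (Fin k → Fin d) (Fin k → Fin d) ℂ}
    (hP : IsStarProjection P) : IsStarProjection (emb e P) :=
  ⟨hP.isIdempotentElem.map (emb e), by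
    show star (emb e P) = emb e P
    rw [star_emb, hP.isSelfAdjoint]⟩

variable {e} in
theorem isLocal_emb (A : Matrix (Fin k → Fin d) (Fin k → Fin d) ℂ) : IsLocal k (emb e A) := by
  classical
  refine ⟨Finset.univ.map (Function.Embedding.inl.trans e.toEmbedding), by simp,
    fun a b => A (fun j => a ⟨e (.inl j), by simp⟩) (fun j => b ⟨e (.inl j), by simp⟩),
    fun x y => ?_⟩
  have hiff : (∀ i, i ∉ Finset.univ.map (Function.Embedding.inl.trans e.toEmbedding) → x i = y i) ↔
      (fun i => x (e (.inr i))) = fun i => y (e (.inr i)) := by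
    constructor
    · intro h
      funext i
      exact h _ (by simp)
    · intro h i hi
      obtain ⟨j, rfl⟩ := e.surjective i
      rcases j with j | j
      · exact absurd (by simp) hi
      · exact congrFun h j
  simp only [hiff]
  show A _ _ * (1 : Matrix (Fin m → Fin d) (Fin m → Fin d) ℂ) (fun i => x (e (.inr i)))
    (fun i => y (e (.inr i))) = _
  rw [Matrix.one_apply, mul_ite, mul_one, mul_zero]
  rfl

/-- A `k`-local operator is of the form `A ⊗ 1` for a splitting with exactly `k` qudits in the first
part. -/
theorem IsLocal.exists_emb (hkn : k ≤ n) {V : Matrix (Fin n → Fin d) (Fin n → Fin d) ℂ}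
    (hV : IsLocal k V) : ∃ (e : Fin k ⊕ Fin (n - k) ≃ Fin n)
      (A : Matrix (Fin k → Fin d) (Fin k → Fin d) ℂ), V = emb e A := by
  classical
  obtain ⟨S, hS, A, hA⟩ := hV
  -- enlarge the set of qudits to one with exactly `k` elements
  obtain ⟨S', hSS', hS'⟩ := Finset.exists_superset_card_eq hS (by simpa using hkn)
  have e₁ : Fin k ≃ {i // i ∈ S'} := (Fintype.equivFinOfCardEq (by simpa using hS')).symm
  have e₂ : Fin (n - k) ≃ {i // ¬ i ∈ S'} := (Fintype.equivFinOfCardEq (by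
    rw [Fintype.card_subtype_compl]; simp [hS'])).symm
  let e : Fin k ⊕ Fin (n - k) ≃ Fin n :=
    (Equiv.sumCongr e₁ e₂).trans (Equiv.sumCompl fun i => i ∈ S')
  have hinl (j : Fin k) : e (.inl j) = (e₁ j).1 := rfl
  have hinr (j : Fin (n - k)) : e (.inr j) = (e₂ j).1 := rfl
  have hpos (i : S) : e (.inl (e₁.symm ⟨i.1, hSS' i.2⟩)) = i.1 := by
    rw [hinl, Equiv.apply_symm_apply]
  refine ⟨e, Matrix.of fun a b => if ∀ j, e (.inl j) ∉ S → a j = b j then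
    A (fun i => a (e₁.symm ⟨i.1, hSS' i.2⟩)) (fun i => b (e₁.symm ⟨i.1, hSS' i.2⟩)) else 0, ?_⟩
  ext x y
  rw [hA]
  show _ = (if ∀ j, e (.inl j) ∉ S → x (e (.inl j)) = y (e (.inl j)) then
    A (fun i => x (e (.inl (e₁.symm ⟨i.1, hSS' i.2⟩))))
      (fun i => y (e (.inl (e₁.symm ⟨i.1, hSS' i.2⟩)))) else 0) *
    (1 : Matrix (Fin (n - k) → Fin d) (Fin (n - k) → Fin d) ℂ) (fun i => x (e (.inr i)))
    (fun i => y (e (.inr i)))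
  simp only [hpos]
  have hiff : (∀ i, i ∉ S → x i = y i) ↔ (∀ j, e (.inl j) ∉ S → x (e (.inl j)) = y (e (.inl j))) ∧
      (fun i => x (e (.inr i))) = fun i => y (e (.inr i)) := by
    constructor
    · refine fun h => ⟨fun j hj => h _ hj, funext fun j => h _ fun hj => (e₂ j).2 (hSS' ?_)⟩
      rwa [hinr] at hj
    · rintro ⟨h1, h2⟩ i hi
      obtain ⟨j, rfl⟩ := e.surjective i
      rcases j with j | j
      · exact h1 j hi
      · exact congrFun h2 j
  rw [Matrix.one_apply, mul_ite, mul_one, mul_zero, if_congr hiff rfl rfl, ite_and, ← ite_and,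
    ← ite_and]
  simp only [and_comm]

end Locality

/-! ### Local invariant unitaries -/

section LocalUnitaries

variable {G : Type*} [Group G] {d k m n : ℕ}

/-- The unitaries `u(g)^{⊗ n}`. -/
def tensorUnitary (u : G →* Matrix.unitaryGroup (Fin d) ℂ) (n : ℕ) :
    G →* Matrix.unitaryGroup (Fin n → Fin d) ℂ where
  toFun g := ⟨tensorPow n (u g : Matrix (Fin d) (Fin d) ℂ), by
    rw [Matrix.mem_unitaryGroup_iff, star_tensorPow, ← map_mul,
      Matrix.mem_unitaryGroup_iff.mp (u g).2, map_one]⟩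
  map_one' := Subtype.ext (by
    show tensorPow n ((u 1).1) = 1
    rw [map_one]; exact map_one _)
  map_mul' g h := Subtype.ext (by
    show tensorPow n ((u (g * h)).1) = tensorPow n (u g).1 * tensorPow n (u h).1
    rw [map_mul]; exact map_mul (tensorPow n) _ _)

variable {u : G →* Matrix.unitaryGroup (Fin d) ℂ}

theorem tensorUnitary_coe (g : G) :
    (tensorUnitary u n g).1 = tensorPow n (u g : Matrix (Fin d) (Fin d) ℂ) := rfl

theorem isInvariant_iff {V : Matrix (Fin n → Fin d) (Fin n → Fin d) ℂ} :
    IsInvariant u V ↔ V ∈ commutant (tensorUnitary u n) := by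
  rw [mem_commutant]
  exact forall_congr' fun g => ⟨fun h => h.symm, fun h => Eq.symm h⟩

theorem circuitGroup_self_eq (u : G →* Matrix.unitaryGroup (Fin d) ℂ) (n : ℕ) :
    circuitGroup u n n = invGroup (tensorUnitary u n) := by
  ext V
  rw [mem_circuitGroup_self, isInvariant_iff, mem_invGroup]

theorem circuitGroup_le (u : G →* Matrix.unitaryGroup (Fin d) ℂ) (n k : ℕ) :
    circuitGroup u n k ≤ invGroup (tensorUnitary u n) := by
  rw [circuitGroup, Subgroup.closure_le]
  exact fun V hV => isInvariant_iff.mp hV.1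

theorem emb_mem_commutant (e : Fin k ⊕ Fin m ≃ Fin n)
    {A : Matrix (Fin k → Fin d) (Fin k → Fin d) ℂ} (hA : A ∈ commutant (tensorUnitary u k)) :
    emb e A ∈ commutant (tensorUnitary u n) := by
  rw [mem_commutant] at hA ⊢
  intro g
  rw [tensorUnitary_coe, tensorPow_eq_splitKron e, emb_eq, splitKron_mul, splitKron_mul,
    ← tensorUnitary_coe, hA, one_mul, mul_one]

theorem mem_commutant_of_emb (e : Fin k ⊕ Fin m ≃ Fin n) [Nonempty (Fin m → Fin d)]
    {A : Matrix (Fin k → Fin d) (Fin k → Fin d) ℂ}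
    (hA : emb e A ∈ commutant (tensorUnitary u n)) : A ∈ commutant (tensorUnitary u k) := by
  rw [mem_commutant] at hA ⊢
  intro g
  have h := hA g
  rw [tensorUnitary_coe, tensorPow_eq_splitKron e, emb_eq, splitKron_mul, splitKron_mul,
    one_mul, mul_one] at h
  -- cancel the invertible factor `u(g)^{⊗ m}`
  have h1 := congrArg (fun B => B * splitKron e 1 (tensorUnitary u m g⁻¹).1) h
  simp only [splitKron_mul, mul_one, ← tensorUnitary_coe] at h1
  rw [← Submonoid.coe_mul, ← map_mul, mul_inv_cancel, map_one] at h1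
  exact emb_injective e h1

/-- The embedding of the invariant unitaries on `k` qudits as local invariant unitaries on `n`
qudits. -/
def embU (e : Fin k ⊕ Fin m ≃ Fin n) :
    invGroup (tensorUnitary u k) →* invGroup (tensorUnitary u n) where
  toFun V := ⟨⟨emb e V.1.1, by
    rw [Matrix.mem_unitaryGroup_iff, star_emb, ← map_mul,
      Matrix.mem_unitaryGroup_iff.mp V.1.2, map_one]⟩, emb_mem_commutant e V.2⟩
  map_one' := Subtype.ext (Subtype.ext (map_one (emb e)))
  map_mul' V W := Subtype.ext (Subtype.ext (map_mul (emb e) _ _))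

theorem embU_mem_circuitGroup (e : Fin k ⊕ Fin m ≃ Fin n) (V : invGroup (tensorUnitary u k)) :
    (embU e V).1 ∈ circuitGroup u n k :=
  Subgroup.subset_closure ⟨isInvariant_iff.mpr (embU e V).2, isLocal_emb V.1.1⟩

/-- The local invariant unitaries are the images of the invariant unitaries on `k` qudits, provided
that the space is nonzero. -/
theorem exists_embU_eq [Nonempty (Fin n → Fin d)] (hkn : k ≤ n)
    {V : Matrix.unitaryGroup (Fin n → Fin d) ℂ} (hV : IsInvariant u V.1) (hloc : IsLocal k V.1) :
    ∃ (e : Fin k ⊕ Fin (n - k) ≃ Fin n) (A : invGroup (tensorUnitary u k)), (embU e A).1 = V := by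
  obtain ⟨e, A, hA⟩ := hloc.exists_emb hkn
  obtain ⟨x⟩ := ‹Nonempty (Fin n → Fin d)›
  have : Nonempty (Fin (n - k) → Fin d) := ⟨fun i => x (e (.inr i))⟩
  rw [isInvariant_iff, hA] at hV
  have hu : A * star A = 1 := by
    apply emb_injective e
    rw [map_mul, ← star_emb, ← hA, map_one]
    exact Matrix.mem_unitaryGroup_iff.mp V.2
  exact ⟨e, ⟨⟨A, Matrix.mem_unitaryGroup_iff.mpr hu⟩, mem_commutant_of_emb e hV⟩,
    Subtype.ext hA.symm⟩

theorem embU_repGate (e : Fin k ⊕ Fin m ≃ Fin n)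
    (W : Subrepresentation (matRep (tensorUnitary u k))) (z : Circle) :
    embU e (repGate W z) = gate (isStarProjection_emb e (projMat_isStarProjection W))
      (emb_mem_commutant e (projMat_mem_commutant W)) z := by
  refine Subtype.ext (Subtype.ext ?_)
  show emb e (1 + ((z : ℂ) - 1) • projMat W) = 1 + ((z : ℂ) - 1) • emb e (projMat W)
  rw [map_add, map_one, map_smul]

end LocalUnitaries

/-! ### The matrix `S` as a matrix of multiplicities -/

section Multiplicities

variable {G : Type*} [Group G] {d k n : ℕ} {u : G →* Matrix.unitaryGroup (Fin d) ℂ}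

theorem Irreps.char_eq {H : Type*} [AddCommGroup H] [Module ℂ H]
    {ρ : Representation ℂ G H} [FiniteDimensional ℂ H]
    (W : Subrepresentation ρ) (hW : W.toRepresentation.IsIrreducible) :
    (irrepClass W hW).char = W.toRepresentation.character := by
  obtain ⟨e⟩ := irrepClass_eq_iff.mp (rfl : irrepClass W hW = irrepClass W hW)
  exact (Representation.char_iso e).symm

theorem continuous_tensorUnitary [TopologicalSpace G] (hu : Continuous u) :
    Continuous (tensorUnitary u n) := by
  refine Continuous.subtype_mk (continuous_matrix fun x y => ?_) _
  show Continuous fun g => ∏ i, (u g : Matrix (Fin d) (Fin d) ℂ) (x i) (y i)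
  have h : Continuous fun g => (u g : Matrix (Fin d) (Fin d) ℂ) := continuous_subtype_val.comp hu
  exact continuous_finsetProd _ fun i _ => h.matrix_elem _ _

variable [TopologicalSpace G] [IsTopologicalGroup G] [CompactSpace G] [MeasurableSpace G]
  [BorelSpace G]

/-- The entries of `S` are multiplicities: `s_ν(λ)` is the multiplicity of `λ` in `ν ⊗ u^{⊗ (n-k)}`,
which is the range of `P_ν ⊗ 1` for every splitting of the qudits. -/
theorem sMatrix_eq_blockRank (hu : Continuous u) (e : Fin k ⊕ Fin (n - k) ≃ Fin n)
    (W : Subrepresentation (matRep (tensorUnitary u k))) (hW : W.toRepresentation.IsIrreducible)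
    (l : Irreps (matRep (tensorUnitary u n))) :
    sMatrix u n k (irrepClass W hW) l = (blockRank l.rep.toRepresentation
      ⟨emb e (projMat W), emb_mem_commutant e (projMat_mem_commutant W)⟩ : ℂ) := by
  have : IsProbabilityMeasure (Measure.haarMeasure (⊤ : TopologicalSpace.PositiveCompacts G)) :=
    ⟨Measure.haarMeasure_self⟩
  rw [blockRank_eq_integral (continuous_tensorUnitary hu) l.rep
    (isStarProjection_emb e (projMat_isStarProjection W)).isIdempotentElem
    (μ := Measure.haarMeasure (⊤ : TopologicalSpace.PositiveCompacts G))]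
  show ∫ g, _ ∂_ = _
  congr 1
  ext g
  have h1 : (irrepClass W hW).char g = (projMat W * tensorPow k (u g).1).trace := by
    rw [Irreps.char_eq, character_eq_trace]; rfl
  have h2 : (emb e (projMat W) * (tensorUnitary u n g).1).trace =
      (projMat W * tensorPow k (u g).1).trace * (u g).1.trace ^ (n - k) := by
    rw [tensorUnitary_coe, tensorPow_eq_splitKron e, emb_eq, splitKron_mul, one_mul,
      trace_splitKron, trace_tensorPow]
  rw [h2, ← h1]
  rw [mul_comm (Irreps.char _ g), mul_right_comm]
  rfl

theorem exists_sMatrix_eq_natCast (hkn : k ≤ n) (hu : Continuous u) :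
    ∃ s : Irreps (matRep (tensorUnitary u k)) → Irreps (matRep (tensorUnitary u n)) → ℕ,
      ∀ ν l, sMatrix u n k ν l = (s ν l : ℂ) := by
  have e : Fin k ⊕ Fin (n - k) ≃ Fin n :=
    finSumFinEquiv.trans (finCongr (Nat.add_sub_cancel' hkn))
  have h (ν : Irreps (matRep (tensorUnitary u k))) (l : Irreps (matRep (tensorUnitary u n))) :
      ∃ a : ℕ, sMatrix u n k ν l = (a : ℂ) := by
    have := sMatrix_eq_blockRank hu e ν.rep ν.rep_isIrreducible l
    exact ⟨_, (congrArg (fun ν => sMatrix u n k ν l) (irrepClass_rep ν).symm).trans this⟩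
  choose s hs using h
  exact ⟨s, hs⟩

variable {s : Irreps (matRep (tensorUnitary u k)) → Irreps (matRep (tensorUnitary u n)) → ℕ}

/-- The determinants of a local invariant unitary are determined, through the matrix `S`, by the
determinants of the invariant unitary on `k` qudits. -/
theorem phase_embU (hu : Continuous u) (hs : ∀ ν l, sMatrix u n k ν l = (s ν l : ℂ))
    (e : Fin k ⊕ Fin (n - k) ≃ Fin n) (V : invGroup (tensorUnitary u k))
    (l : Irreps (matRep (tensorUnitary u n))) :
    phase l (embU e V) = ∏ ν, phase ν V ^ s ν l := by
  classical
  induction V using invGroup_induction with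
  | one => simp
  | mul_gate V W z hW h =>
    simp only [map_mul, h, mul_pow, Finset.prod_mul_distrib]
    congr 1
    have h1 : blockRank l.rep.toRepresentation
        ⟨emb e (projMat W), emb_mem_commutant e (projMat_mem_commutant W)⟩ =
        s (irrepClass W hW) l := by
      have := (sMatrix_eq_blockRank hu e W hW l).symm.trans (hs _ l)
      exact_mod_cast this
    rw [embU_repGate, phase_gate, h1, Finset.prod_eq_single (irrepClass W hW)]
    · rw [phase_repGate _ hW, if_pos rfl]
    · intro ν _ hν
      rw [phase_repGate _ hW, if_neg (Ne.symm hν), one_pow]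
    · simp

end Multiplicities

/-! ### Local circuits as the preimage of a torus -/

section CircuitGroup

variable {X : Type*} [Fintype X] [DecidableEq X] {G : Type*} [Group G]
variable {U : G →* Matrix.unitaryGroup X ℂ}

variable (U) in
/-- The determinants of an invariant unitary on all multiplicity spaces. -/
def phases : invGroup U →* (Irreps (matRep U) → Circle) := MonoidHom.pi phase

theorem phases_apply (V : invGroup U) (l : Irreps (matRep U)) : phases U V l = phase l V := rfl

/-- The homomorphism of tori given by a matrix of natural numbers. -/
def torusHom {I J : Type*} [Fintype I] (s : I → J → ℕ) : (I → Circle) →* (J → Circle) where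
  toFun θ l := ∏ ν, θ ν ^ s ν l
  map_one' := by ext1 l; simp
  map_mul' θ η := by ext1 l; simp [mul_pow, Finset.prod_mul_distrib]

theorem torusHom_apply {I J : Type*} [Fintype I] (s : I → J → ℕ) (θ : I → Circle) (l : J) :
    torusHom s θ l = ∏ ν, θ ν ^ s ν l := rfl

/-- The determinants on the multiplicity spaces can be prescribed arbitrarily. -/
theorem exists_phase_eq (θ : Irreps (matRep U) → Circle) :
    ∃ V : invGroup U, phases U V = θ := by
  classical
  refine ⟨(Finset.univ.toList.map fun l => repGate l.rep (θ l)).prod, funext fun l => ?_⟩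
  rw [phases_apply, map_list_prod, List.map_map, Finset.prod_map_toList, Finset.prod_eq_single l]
  · rw [Function.comp_apply, phase_repGate l l.rep_isIrreducible, irrepClass_rep, if_pos rfl]
  · intro l' _ hl'
    rw [Function.comp_apply, phase_repGate l l'.rep_isIrreducible, irrepClass_rep, if_neg hl']
  · simp

end CircuitGroup

section CircuitGroup

variable {G : Type*} [Group G] {d k n : ℕ} {u : G →* Matrix.unitaryGroup (Fin d) ℂ}

theorem mem_circuitGroup_of_mem_commutator (hsemi : IsSemiUniversal u n k)
    {V : invGroup (tensorUnitary u n)} (hV : V ∈ commutator (invGroup (tensorUnitary u n))) :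
    V.1 ∈ circuitGroup u n k := by
  refine hsemi ?_
  rw [circuitGroup_self_eq, ← Subgroup.map_subtype_commutator]
  exact ⟨V, hV, rfl⟩

variable [TopologicalSpace G] [IsTopologicalGroup G] [CompactSpace G] [MeasurableSpace G]
  [BorelSpace G]
  {s : Irreps (matRep (tensorUnitary u k)) → Irreps (matRep (tensorUnitary u n)) → ℕ}

/-- Under semi-universality, the group generated by the local invariant unitaries is the preimage,
under the determinants, of the subtorus parametrized by the matrix `S`. -/
theorem mem_circuitGroup_iff (hkn : k ≤ n) (hu : Continuous u) (hsemi : IsSemiUniversal u n k)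
    (hs : ∀ ν l, sMatrix u n k ν l = (s ν l : ℂ)) (V : invGroup (tensorUnitary u n)) :
    V.1 ∈ circuitGroup u n k ↔ phases (tensorUnitary u n) V ∈ (torusHom s).range := by
  constructor
  · have hle : circuitGroup u n k ≤
        ((torusHom s).range.comap (phases (tensorUnitary u n))).map (Subgroup.subtype _) := by
      rw [circuitGroup, Subgroup.closure_le]
      rintro V ⟨hV, hVloc⟩
      rcases isEmpty_or_nonempty (Fin n → Fin d) with hX | hX
      · -- on the zero space the only unitary is the identity
        exact ⟨1, one_mem _, Subtype.ext (Subsingleton.elim _ _)⟩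
      · obtain ⟨e, A, rfl⟩ := exists_embU_eq hkn hV hVloc
        exact ⟨embU e A, ⟨phases _ A, funext fun l => (phase_embU hu hs e A l).symm⟩, rfl⟩
    intro hV
    obtain ⟨V', hV', hVV'⟩ := hle hV
    rwa [← Subtype.ext hVV']
  · rintro ⟨θ, hθ⟩
    have e : Fin k ⊕ Fin (n - k) ≃ Fin n :=
      finSumFinEquiv.trans (finCongr (Nat.add_sub_cancel' hkn))
    -- a local invariant unitary has the same determinants, so it differs from `V` by commutators
    obtain ⟨A, rfl⟩ := exists_phase_eq θ
    have h1 : V * (embU e A)⁻¹ ∈ commutator (invGroup (tensorUnitary u n)) := by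
      refine mem_commutator_of_phase_eq_one fun l => ?_
      rw [map_mul, map_inv, phase_embU hu hs, ← phases_apply, ← hθ]
      exact mul_inv_cancel _
    have h2 := mul_mem (mem_circuitGroup_of_mem_commutator hsemi h1)
      (embU_mem_circuitGroup e A)
    rw [← Subgroup.coe_mul, inv_mul_cancel_right] at h2
    exact h2

end CircuitGroup

/-! ### Compactness -/

section Compactness

variable {X : Type*} [Fintype X] [DecidableEq X]

theorem compactSpace_unitaryGroup : CompactSpace (Matrix.unitaryGroup X ℂ) := by
  suffices h : IsCompact (Matrix.unitaryGroup X ℂ : Set (Matrix X X ℂ)) from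
    isCompact_iff_compactSpace.mp h
  have hK : IsCompact
      (Set.univ.pi fun _ : X => Set.univ.pi fun _ : X => Metric.closedBall (0 : ℂ) 1) :=
    isCompact_univ_pi fun _ => isCompact_univ_pi fun _ => isCompact_closedBall _ _
  refine hK.of_isClosed_subset (isClosed_unitary (R := Matrix X X ℂ)) fun V hV => ?_
  intro i _ j _
  rw [mem_closedBall_zero_iff]
  exact entry_norm_bound_of_unitary hV i j

variable {G : Type*} [Group G] {U : G →* Matrix.unitaryGroup X ℂ}

theorem isClosed_invGroup : IsClosed (invGroup U : Set (Matrix.unitaryGroup X ℂ)) := by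
  have h : (invGroup U : Set (Matrix.unitaryGroup X ℂ)) =
      ⋂ g, {V | (U g : Matrix X X ℂ) * V.1 = V.1 * (U g : Matrix X X ℂ)} := by
    ext V
    rw [SetLike.mem_coe, mem_invGroup, mem_commutant]
    simp
  rw [h]
  exact isClosed_iInter fun g => isClosed_eq (continuous_const.mul continuous_subtype_val)
    (continuous_subtype_val.mul continuous_const)

/-- The determinants on the multiplicity spaces are homogeneous polynomials in the entries: the
matrix entries of the action on a multiplicity space are linear functionals on the commutant, and
extend to all matrices. -/
theorem exists_blockDet_eq_det (l : Irreps (matRep U)) :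
    ∃ c : Fin l.mult → Fin l.mult → Matrix X X ℂ →ₗ[ℂ] ℂ,
      ∀ V : invGroup U, blockDet l V = (Matrix.of fun i j => c i j V.1.1).det := by
  let b := Module.finBasis ℂ (l.rep.toRepresentation.IntertwiningMap (matRep U))
  have h (i j : Fin l.mult) : ∃ c : Matrix X X ℂ →ₗ[ℂ] ℂ, ∀ A : commutant U,
      c A.1 = LinearMap.toMatrix b b (blockHom l.rep.toRepresentation A) i j := by
    let f : (Subalgebra.toSubmodule (commutant U)) →ₗ[ℂ] ℂ :=
      { toFun A := LinearMap.toMatrix b b (blockHom l.rep.toRepresentation A) i j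
        map_add' A B := by
          show LinearMap.toMatrix b b (blockHom l.rep.toRepresentation
            ((A : commutant U) + (B : commutant U))) i j = _
          rw [map_add, map_add]; rfl
        map_smul' a A := by
          show LinearMap.toMatrix b b (blockHom l.rep.toRepresentation
            (a • (A : commutant U))) i j = _
          rw [map_smul, map_smul]; rfl }
    obtain ⟨c, hc⟩ := f.exists_extend
    exact ⟨c, fun A => congrArg (fun F => F A) hc⟩
  choose c hc using h
  refine ⟨c, fun V => ?_⟩
  show LinearMap.det (blockHom l.rep.toRepresentation ⟨V.1.1, V.2⟩) = _
  rw [← LinearMap.det_toMatrix b]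
  congr 1
  ext i j
  exact (hc i j ⟨V.1.1, V.2⟩).symm

theorem continuous_phases : Continuous (phases U) := by
  refine continuous_pi fun l => continuous_induced_rng.mpr ?_
  obtain ⟨c, hc⟩ := exists_blockDet_eq_det l
  have h : (fun V => (phases U V l : ℂ)) =
      fun V : invGroup U => (Matrix.of fun i j => c i j V.1.1).det := funext hc
  show Continuous fun V => (phases U V l : ℂ)
  rw [h]
  refine Continuous.matrix_det (continuous_matrix fun i j => ?_)
  exact (c i j).continuous_of_finiteDimensional.comp
    (continuous_subtype_val.comp continuous_subtype_val)

theorem isClosed_range_torusHom {I J : Type*} [Fintype I] (s : I → J → ℕ) :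
    IsClosed ((torusHom s).range : Set (J → Circle)) := by
  have h : Continuous (torusHom s) := continuous_pi fun l => by
    show Continuous fun θ : I → Circle => ∏ ν, θ ν ^ s ν l
    fun_prop
  exact (isCompact_range h).isClosed

end Compactness

section CircuitCompact

variable {G : Type*} [Group G] {d k n : ℕ} {u : G →* Matrix.unitaryGroup (Fin d) ℂ}

variable (u n) in
theorem isCompact_circuitGroup_self :
    IsCompact (circuitGroup u n n : Set (Matrix.unitaryGroup (Fin n → Fin d) ℂ)) := by
  have := compactSpace_unitaryGroup (X := Fin n → Fin d)
  rw [circuitGroup_self_eq]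
  exact isClosed_invGroup.isCompact

variable [TopologicalSpace G] [IsTopologicalGroup G] [CompactSpace G] [MeasurableSpace G]
  [BorelSpace G]

theorem isCompact_circuitGroup (hkn : k ≤ n) (hu : Continuous u) (hsemi : IsSemiUniversal u n k) :
    IsCompact (circuitGroup u n k : Set (Matrix.unitaryGroup (Fin n → Fin d) ℂ)) := by
  have := compactSpace_unitaryGroup (X := Fin n → Fin d)
  obtain ⟨s, hs⟩ := exists_sMatrix_eq_natCast hkn hu
  have h : (circuitGroup u n k : Set (Matrix.unitaryGroup (Fin n → Fin d) ℂ)) =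
      Subtype.val '' (phases (tensorUnitary u n) ⁻¹' (torusHom s).range) := by
    ext V
    constructor
    · intro hV
      exact ⟨⟨V, circuitGroup_le u n k hV⟩, (mem_circuitGroup_iff hkn hu hsemi hs _).mp hV, rfl⟩
    · rintro ⟨V, hV, rfl⟩
      exact (mem_circuitGroup_iff hkn hu hsemi hs _).mpr hV
  rw [h]
  exact ((isClosed_invGroup.isClosedEmbedding_subtypeVal.isClosedMap _
    ((isClosed_range_torusHom s).preimage continuous_phases))).isCompact

end CircuitCompact

/-! ### Polynomials in the entries of a unitary -/

theorem prod_mem_prod_submodule {R A ι : Type*} [CommSemiring R] [CommSemiring A] [Algebra R A]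
    (s : Finset ι) {M : ι → Submodule R A} {f : ι → A} (h : ∀ i ∈ s, f i ∈ M i) :
    ∏ i ∈ s, f i ∈ ∏ i ∈ s, M i := by
  classical
  induction s using Finset.induction_on with
  | empty =>
    rw [Finset.prod_empty, Finset.prod_empty]
    exact Submodule.one_le.mp (le_refl (1 : Submodule R A))
  | insert i s hi ih =>
    rw [Finset.prod_insert hi, Finset.prod_insert hi]
    exact Submodule.mul_mem_mul (h i (Finset.mem_insert_self i s))
      (ih fun j hj => h j (Finset.mem_insert_of_mem hj))

theorem det_mem_pow {α : Type*} {m : ℕ} {S : Submodule ℂ (α → ℂ)} {F : Fin m → Fin m → α → ℂ}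
    (hF : ∀ i j, F i j ∈ S) : (fun a => (Matrix.of fun i j => F i j a).det) ∈ S ^ m := by
  have h : (fun a => (Matrix.of fun i j => F i j a).det) =
      ∑ σ : Equiv.Perm (Fin m), ((Equiv.Perm.sign σ : ℤ) : ℂ) • ∏ i, F (σ i) i := by
    funext a
    rw [Matrix.det_apply', Finset.sum_apply]
    refine Finset.sum_congr rfl fun σ _ => ?_
    rw [Pi.smul_apply, Finset.prod_apply, smul_eq_mul]
    rfl
  rw [h]
  refine Submodule.sum_mem _ fun σ _ => Submodule.smul_mem _ _ ?_
  have := prod_mem_prod_submodule Finset.univ (M := fun _ : Fin m => S)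
    (f := fun i => F (σ i) i) fun i _ => hF _ _
  simpa using this

section Polynomials

variable {X : Type*} [Fintype X] [DecidableEq X]

variable (X) in
/-- The linear functions of the entries of a unitary matrix. -/
def entrySpan : Submodule ℂ (Matrix.unitaryGroup X ℂ → ℂ) :=
  Submodule.span ℂ (Set.range fun p : X × X => fun V => V.1 p.1 p.2)

variable (X) in
/-- The linear functions of the conjugated entries of a unitary matrix. -/
def conjEntrySpan : Submodule ℂ (Matrix.unitaryGroup X ℂ → ℂ) :=
  Submodule.span ℂ (Set.range fun p : X × X => fun V => star (V.1 p.1 p.2))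

variable (X) in
/-- The functions on the unitary group that are homogeneous polynomials of degree `a` in the entries
and of degree `b` in the conjugated entries. -/
def polySpan (a b : ℕ) : Submodule ℂ (Matrix.unitaryGroup X ℂ → ℂ) :=
  entrySpan X ^ a * conjEntrySpan X ^ b

theorem polySpan_mul (a b a' b' : ℕ) :
    polySpan X a b * polySpan X a' b' = polySpan X (a + a') (b + b') := by
  rw [polySpan, polySpan, polySpan, pow_add, pow_add, mul_mul_mul_comm]

theorem linear_eq_sum (c : Matrix X X ℂ →ₗ[ℂ] ℂ) (A : Matrix X X ℂ) :
    c A = ∑ i, ∑ j, A i j * c (Matrix.single i j 1) := by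
  conv_lhs => rw [Matrix.matrix_eq_sum_single A]
  simp only [map_sum]
  refine Finset.sum_congr rfl fun i _ => Finset.sum_congr rfl fun j _ => ?_
  rw [← smul_eq_mul, ← map_smul, Matrix.smul_single, smul_eq_mul, mul_one]

theorem linear_mem_entrySpan (c : Matrix X X ℂ →ₗ[ℂ] ℂ) :
    (fun V : Matrix.unitaryGroup X ℂ => c V.1) ∈ entrySpan X := by
  have h : (fun V : Matrix.unitaryGroup X ℂ => c V.1) =
      ∑ i, ∑ j, c (Matrix.single i j 1) • fun V : Matrix.unitaryGroup X ℂ => V.1 i j := by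
    funext V
    rw [linear_eq_sum]
    simp [Finset.sum_apply, mul_comm]
  rw [h]
  exact Submodule.sum_mem _ fun i _ => Submodule.sum_mem _ fun j _ =>
    Submodule.smul_mem _ _ (Submodule.subset_span ⟨(i, j), rfl⟩)

theorem star_linear_mem_conjEntrySpan (c : Matrix X X ℂ →ₗ[ℂ] ℂ) :
    (fun V : Matrix.unitaryGroup X ℂ => star (c V.1)) ∈ conjEntrySpan X := by
  have h : (fun V : Matrix.unitaryGroup X ℂ => star (c V.1)) = ∑ i, ∑ j,
      star (c (Matrix.single i j 1)) • fun V : Matrix.unitaryGroup X ℂ => star (V.1 i j) := by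
    funext V
    rw [linear_eq_sum]
    simp [Finset.sum_apply, mul_comm]
  rw [h]
  exact Submodule.sum_mem _ fun i _ => Submodule.sum_mem _ fun j _ =>
    Submodule.smul_mem _ _ (Submodule.subset_span ⟨(i, j), rfl⟩)

/-- The function `1 = ∑_j |V_{ij}|²` is a polynomial of every balanced degree. -/
theorem one_mem_polySpan [Nonempty X] (t : ℕ) : 1 ∈ polySpan X t t := by
  have h1 : 1 ∈ entrySpan X * conjEntrySpan X := by
    obtain ⟨i⟩ := ‹Nonempty X›
    have h : (1 : Matrix.unitaryGroup X ℂ → ℂ) = ∑ j, (fun V : Matrix.unitaryGroup X ℂ => V.1 i j) *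
        fun V : Matrix.unitaryGroup X ℂ => star (V.1 i j) := by
      funext V
      have := congrFun (congrFun (Matrix.mem_unitaryGroup_iff.mp V.2) i) i
      rw [Matrix.mul_apply, Matrix.one_apply_eq] at this
      rw [Finset.sum_apply]
      exact this.symm
    rw [h]
    exact Submodule.sum_mem _ fun j _ => Submodule.mul_mem_mul (Submodule.subset_span ⟨(i, j), rfl⟩)
      (Submodule.subset_span ⟨(i, j), rfl⟩)
  have := Submodule.pow_mem_pow _ h1 t
  rwa [one_pow, mul_pow] at this

/-- A `t`-design reproduces the averages of all polynomials of degree `(t, t)`. These are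
continuous, hence integrable, as additivity of the integral requires. -/
theorem integral_eq_of_isTDesign {t : ℕ} {μ ν : Measure (Matrix.unitaryGroup X ℂ)}
    [IsFiniteMeasure μ] [IsFiniteMeasure ν] (h : IsTDesign t μ ν)
    {f : Matrix.unitaryGroup X ℂ → ℂ} (hf : f ∈ polySpan X t t) :
    Continuous f ∧ ∫ V, f V ∂μ = ∫ V, f V ∂ν := by
  have := compactSpace_unitaryGroup (X := X)
  rw [polySpan, entrySpan, conjEntrySpan, Submodule.span_pow, Submodule.span_pow,
    Submodule.span_mul_span] at hf
  induction hf using Submodule.span_induction with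
  | mem f hf =>
    obtain ⟨_, hp, _, hq, rfl⟩ := Set.mem_mul.mp hf
    obtain ⟨p, rfl⟩ := Set.mem_pow.mp hp
    obtain ⟨q, rfl⟩ := Set.mem_pow.mp hq
    have hp' (i : Fin t) : ∃ x : X × X, (fun V : Matrix.unitaryGroup X ℂ => V.1 x.1 x.2) = p i :=
      (p i).2
    have hq' (i : Fin t) :
        ∃ x : X × X, (fun V : Matrix.unitaryGroup X ℂ => star (V.1 x.1 x.2)) = q i := (q i).2
    choose x hx using hp'
    choose y hy using hq'
    simp only [← hx, ← hy, List.prod_ofFn]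
    have hfun : ((∏ i, fun V : Matrix.unitaryGroup X ℂ => V.1 (x i).1 (x i).2) *
        ∏ i, fun V : Matrix.unitaryGroup X ℂ => star (V.1 (y i).1 (y i).2)) =
        fun V : Matrix.unitaryGroup X ℂ => (∏ i, V.1 (x i).1 (x i).2) *
          ∏ i, star (V.1 (y i).1 (y i).2) := by
      funext V
      simp [Finset.prod_apply]
    rw [hfun]
    refine ⟨?_, congrFun (congrFun h (fun i => (x i).1, fun i => (y i).1))
      (fun i => (x i).2, fun i => (y i).2)⟩
    have hc (a b : X) : Continuous fun V : Matrix.unitaryGroup X ℂ => V.1 a b :=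
      continuous_subtype_val.matrix_elem a b
    exact (continuous_finsetProd _ fun i _ => hc _ _).mul
      (continuous_finsetProd _ fun i _ => (hc _ _).star)
  | zero => exact ⟨continuous_const, by simp⟩
  | add f g _ _ hf hg =>
    refine ⟨hf.1.add hg.1, ?_⟩
    simp only [Pi.add_apply]
    rw [integral_add (integrable_of_continuous hf.1) (integrable_of_continuous hg.1),
      integral_add (integrable_of_continuous hf.1) (integrable_of_continuous hg.1), hf.2, hg.2]
  | smul c f _ hf =>
    refine ⟨hf.1.const_smul c, ?_⟩
    simp only [Pi.smul_apply, integral_smul, hf.2]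

/-- Averages over the uniform distribution on a group are averages over its Haar measure. -/
theorem exists_isHaar_of_isUniformOn {W : Subgroup (Matrix.unitaryGroup X ℂ)}
    {μ : Measure (Matrix.unitaryGroup X ℂ)} (h : IsUniformOn W μ) :
    IsProbabilityMeasure μ ∧ ∃ η : Measure W, η.IsMulLeftInvariant ∧ IsProbabilityMeasure η ∧
      ∀ f : Matrix.unitaryGroup X ℂ → ℂ, Continuous f → ∫ V, f V ∂μ = ∫ V, f V.1 ∂η := by
  obtain ⟨η, hη, hη', rfl⟩ := h
  refine ⟨Measure.isProbabilityMeasure_map measurable_subtype_coe.aemeasurable, η, inferInstance,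
    hη', fun f hf => ?_⟩
  exact integral_map measurable_subtype_coe.aemeasurable hf.aestronglyMeasurable

/-- A nontrivial character of a group has mean zero. -/
theorem integral_character_eq_zero {H : Type*} [Group H] [MeasurableSpace H] [MeasurableMul H]
    {η : Measure H} [η.IsMulLeftInvariant] (χ : H →* Circle) {V₀ : H} (hV₀ : χ V₀ ≠ 1) :
    ∫ V, (χ V : ℂ) ∂η = 0 := by
  have h := integral_mul_left_eq_self (μ := η) (fun V => (χ V : ℂ)) V₀
  simp only [map_mul, Circle.coe_mul, integral_const_mul] at h
  have h1 : ((χ V₀ : ℂ) - 1) * ∫ V, (χ V : ℂ) ∂η = 0 := by rw [sub_mul, h, one_mul, sub_self]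
  rcases mul_eq_zero.mp h1 with h2 | h2
  · exact absurd (Circle.ext (by rw [sub_eq_zero.mp h2, Circle.coe_one])) hV₀
  · exact h2

theorem circle_zpow_eq (z : Circle) (q : ℤ) :
    ((z ^ q : Circle) : ℂ) = (z : ℂ) ^ q.toNat * star (z : ℂ) ^ (-q).toNat := by
  have hz : star (z : ℂ) = ((z⁻¹ : Circle) : ℂ) := (Circle.coe_inv_eq_conj z).symm
  rw [hz, ← Circle.coe_pow, ← Circle.coe_pow, ← Circle.coe_mul]
  congr 1
  rw [inv_pow, ← zpow_natCast, ← zpow_natCast, ← zpow_neg, ← zpow_add]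
  congr 1
  omega

/-- The integers are determined by the characters of the circle. -/
theorem circle_zpow_injective {a b : ℤ} (h : ∀ z : Circle, z ^ a = z ^ b) : a = b := by
  by_contra hab
  have h0 : ((a - b : ℤ) : ℝ) ≠ 0 := by exact_mod_cast sub_ne_zero.mpr hab
  -- at `z = exp(iπ / (a - b))` the two powers differ by the factor `-1`
  apply Circle.exp_pi_ne_one
  have h1 := h (Circle.exp (Real.pi / ((a - b : ℤ) : ℝ)))
  rw [← div_eq_one, div_eq_mul_inv, ← zpow_sub, ← Circle.exp_intCast_mul,
    mul_div_cancel₀ _ h0] at h1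
  exact h1

end Polynomials

/-! ### Characters of the group of invariant unitaries -/

section BlockCharacters

variable {X : Type*} [Fintype X] [DecidableEq X] {G : Type*} [Group G]
variable {U : G →* Matrix.unitaryGroup X ℂ}

/-- The character `V ↦ ∏_λ det(V_λ)^{q(λ)}` of the group of invariant unitaries. -/
def blockChar (q : Irreps (matRep U) → ℤ) : invGroup U →* Circle where
  toFun V := ∏ l, phase l V ^ q l
  map_one' := by simp
  map_mul' V W := by simp [mul_zpow, Finset.prod_mul_distrib]

theorem blockChar_apply (q : Irreps (matRep U) → ℤ) (V : invGroup U) :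
    blockChar q V = ∏ l, phase l V ^ q l := rfl

theorem blockChar_repGate (q : Irreps (matRep U) → ℤ) (l : Irreps (matRep U)) (z : Circle) :
    blockChar q (repGate l.rep z) = z ^ q l := by
  classical
  rw [blockChar_apply, Finset.prod_eq_single l]
  · rw [phase_repGate l l.rep_isIrreducible, irrepClass_rep, if_pos rfl]
  · intro l' _ hl'
    rw [phase_repGate l' l.rep_isIrreducible, irrepClass_rep, if_neg (Ne.symm hl'), one_zpow]
  · simp

theorem exists_blockChar_ne_one {q : Irreps (matRep U) → ℤ} (hq : q ≠ 0) :
    ∃ V, blockChar q V ≠ 1 := by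
  by_contra! hcon
  refine hq (funext fun l => circle_zpow_injective fun z => ?_)
  rw [← blockChar_repGate, hcon, Pi.zero_apply, zpow_zero]

/-- The characters of the group of invariant unitaries extend to polynomials on the unitary group:
the determinants are polynomials of degree `m_λ`, and negative powers are conjugates of positive
ones. -/
theorem exists_polySpan_eq_blockChar (q : Irreps (matRep U) → ℤ) :
    ∃ f ∈ polySpan X (∑ l, l.mult * (q l).toNat) (∑ l, l.mult * (-q l).toNat),
      ∀ V : invGroup U, f V.1 = (blockChar q V : ℂ) := by
  choose c hc using fun l : Irreps (matRep U) => exists_blockDet_eq_det l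
  let f (l : Irreps (matRep U)) (V : Matrix.unitaryGroup X ℂ) : ℂ :=
    (Matrix.of fun i j => c l i j V.1).det
  have hf (l) : f l ∈ entrySpan X ^ l.mult := det_mem_pow fun i j => linear_mem_entrySpan _
  let f' (l : Irreps (matRep U)) (V : Matrix.unitaryGroup X ℂ) : ℂ :=
    (Matrix.of fun i j => star (c l i j V.1)).det
  have hf' (l) : f' l ∈ conjEntrySpan X ^ l.mult :=
    det_mem_pow fun i j => star_linear_mem_conjEntrySpan _
  have hff' (l V) : f' l V = star (f l V) := by
    have := RingHom.map_det (starRingEnd ℂ) (Matrix.of fun i j => c l i j V.1)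
    exact this.symm
  refine ⟨(∏ l, f l ^ (q l).toNat) * ∏ l, f' l ^ (-q l).toNat, ?_, fun V => ?_⟩
  · refine Submodule.mul_mem_mul ?_ ?_
    · rw [← Finset.prod_pow_eq_pow_sum]
      refine prod_mem_prod_submodule _ fun l _ => ?_
      rw [pow_mul]
      exact Submodule.pow_mem_pow _ (hf l) _
    · rw [← Finset.prod_pow_eq_pow_sum]
      refine prod_mem_prod_submodule _ fun l _ => ?_
      rw [pow_mul]
      exact Submodule.pow_mem_pow _ (hf' l) _
  · have h1 : (blockChar q V : ℂ) = ∏ l, ((phase l V ^ q l : Circle) : ℂ) :=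
      map_prod Circle.coeHom _ _
    rw [h1, Pi.mul_apply, Finset.prod_apply, Finset.prod_apply, ← Finset.prod_mul_distrib]
    refine Finset.prod_congr rfl fun l _ => ?_
    rw [circle_zpow_eq, Pi.pow_apply, Pi.pow_apply, hff', phase_coe, hc]

end BlockCharacters

/-! ### The moment representation -/

section Moments

open scoped Kronecker

variable {X : Type*} [Fintype X] [DecidableEq X]

theorem map_star_mem_unitaryGroup (V : Matrix.unitaryGroup X ℂ) :
    (V.1.map star) * star (V.1.map star) = 1 := by
  have h := congrArg (fun A : Matrix X X ℂ => A.map (starRingEnd ℂ))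
    (Matrix.mem_unitaryGroup_iff.mp V.2)
  simp only [Matrix.map_mul] at h
  rw [Matrix.map_one _ (map_zero _) (map_one _)] at h
  exact h

/-- The representation `V ↦ V^{⊗ t} ⊗ (V^*)^{⊗ t}` of the unitary group. -/
def momentRep (t : ℕ) :
    Matrix.unitaryGroup X ℂ →* Matrix.unitaryGroup ((Fin t → X) × (Fin t → X)) ℂ where
  toFun V := ⟨tensorPow t V.1 ⊗ₖ tensorPow t (V.1.map star), by
    rw [Matrix.mem_unitaryGroup_iff, Matrix.star_eq_conjTranspose, Matrix.conjTranspose_kronecker,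
      ← Matrix.mul_kronecker_mul, ← Matrix.star_eq_conjTranspose, ← Matrix.star_eq_conjTranspose,
      star_tensorPow, star_tensorPow, ← map_mul, ← map_mul, map_star_mem_unitaryGroup,
      Matrix.mem_unitaryGroup_iff.mp V.2, map_one, Matrix.one_kronecker_one]⟩
  map_one' := Subtype.ext (by
    show tensorPow t (1 : Matrix X X ℂ) ⊗ₖ tensorPow t ((1 : Matrix X X ℂ).map star) = 1
    rw [Matrix.map_one _ (star_zero ℂ) (star_one ℂ), map_one, Matrix.one_kronecker_one])
  map_mul' V W := Subtype.ext (by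
    show tensorPow t (V.1 * W.1) ⊗ₖ tensorPow t ((V.1 * W.1).map star) =
      (tensorPow t V.1 ⊗ₖ tensorPow t (V.1.map star)) *
        (tensorPow t W.1 ⊗ₖ tensorPow t (W.1.map star))
    have h : (V.1 * W.1).map star = V.1.map star * W.1.map star :=
      Matrix.map_mul (f := starRingEnd ℂ)
    rw [← Matrix.mul_kronecker_mul, h, map_mul, map_mul])

theorem momentRep_coe (t : ℕ) (V : Matrix.unitaryGroup X ℂ) :
    (momentRep t V).1 = tensorPow t V.1 ⊗ₖ tensorPow t (V.1.map star) := rfl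

theorem continuous_momentRep (t : ℕ) :
    Continuous fun V : Matrix.unitaryGroup X ℂ => (momentRep t V).1 := by
  refine continuous_matrix fun a b => ?_
  have hc (i j : X) : Continuous fun V : Matrix.unitaryGroup X ℂ => V.1 i j :=
    continuous_subtype_val.matrix_elem i j
  show Continuous fun V : Matrix.unitaryGroup X ℂ =>
    (∏ i, V.1 (a.1 i) (b.1 i)) * ∏ i, star (V.1 (a.2 i) (b.2 i))
  exact (continuous_finsetProd _ fun i _ => hc _ _).mul
    (continuous_finsetProd _ fun i _ => (hc _ _).star)

theorem star_intMat {Ω I : Type*} [MeasurableSpace Ω] {μ : Measure Ω} (M : Ω → Matrix I I ℂ) :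
    star (intMat μ M) = intMat μ fun x => star (M x) := by
  ext i j
  exact (integral_conj (f := fun x => M x j i)).symm

variable {K L : Subgroup (Matrix.unitaryGroup X ℂ)} {μ ν : Measure (Matrix.unitaryGroup X ℂ)}

theorem momentRep_mul_moment [CompactSpace K] (hμ : IsUniformOn K μ) (t : ℕ)
    {V : Matrix.unitaryGroup X ℂ} (hV : V ∈ K) :
    (momentRep t V).1 * moment t μ = moment t μ := by
  obtain ⟨_, η, hη, hη', hint⟩ := exists_isHaar_of_isUniformOn hμ
  have hc : Continuous fun W : K => (momentRep t W.1).1 :=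
    (continuous_momentRep t).comp continuous_subtype_val
  have hM : moment t μ = intMat η fun W : K => (momentRep t W.1).1 := by
    ext a b
    exact hint _ ((continuous_momentRep t).matrix_elem a b)
  rw [hM, ← intMat_mul_left _ hc]
  ext a b
  simp only [intMat, Matrix.of_apply]
  rw [← integral_mul_left_eq_self (fun W : K => (momentRep t W.1).1 a b) ⟨V, hV⟩]
  congr 1
  ext W
  rw [Subgroup.coe_mul, map_mul]
  rfl

/-- The average of the adjoints over a group fixes every matrix that is fixed by the group. -/
theorem star_moment_mul [CompactSpace K] (hμ : IsUniformOn K μ) {t : ℕ}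
    {A : Matrix ((Fin t → X) × (Fin t → X)) ((Fin t → X) × (Fin t → X)) ℂ}
    (hA : ∀ V ∈ K, (momentRep t V).1 * A = A) : star (moment t μ) * A = A := by
  obtain ⟨_, η, hη, hη', hint⟩ := exists_isHaar_of_isUniformOn hμ
  have hc : Continuous fun W : K => star (momentRep t W.1).1 :=
    ((continuous_momentRep t).comp continuous_subtype_val).star
  have hM : moment t μ = intMat η fun W : K => (momentRep t W.1).1 := by
    ext a b
    exact hint _ ((continuous_momentRep t).matrix_elem a b)
  rw [hM, star_intMat, ← intMat_mul_right _ hc]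
  have h : (fun W : K => star (momentRep t W.1).1 * A) = fun _ => A := by
    funext W
    conv_lhs => rw [← hA W.1 W.2]
    rw [← mul_assoc, Matrix.mem_unitaryGroup_iff'.mp (momentRep t W.1).2, one_mul]
  rw [h, intMat_const]

/-- The moments of two groups `K ≤ L` are the orthogonal projections onto their fixed vectors, so
they agree as soon as the vectors fixed by `K` are fixed by `L`. -/
theorem moment_eq_of_forall_mul_eq [CompactSpace K] [CompactSpace L] (hKL : K ≤ L)
    (hμ : IsUniformOn K μ) (hν : IsUniformOn L ν) {t : ℕ}
    (h : ∀ V ∈ L, (momentRep t V).1 * moment t μ = moment t μ) : moment t μ = moment t ν := by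
  have hμs : star (moment t μ) = moment t μ := by
    have h1 := star_moment_mul hμ fun V hV => momentRep_mul_moment hμ t hV
    conv_lhs => rw [← h1]
    rw [star_mul, star_star, h1]
  have h1 := star_moment_mul hν h
  have h2 := star_moment_mul hμ fun V hV => momentRep_mul_moment hν t (hKL hV)
  have h3 := congrArg star h1
  rw [star_mul, star_star, hμs] at h3
  rw [hμs] at h2
  exact h3.symm.trans h2

end Moments

/-! ### Characters occurring on the vectors fixed by a subgroup -/

section Eigenvector

variable {H Y : Type*} [Group H] [Fintype Y] [DecidableEq Y]

/-- If a vector fixed by a subgroup `N` that contains all commutators is not fixed by the whole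
group, then some nontrivial character that is trivial on `N` has an eigenvector: the group acts on
the vectors fixed by `N` by commuting unitaries. -/
theorem exists_character_of_not_fixed (R : H →* Matrix.unitaryGroup Y ℂ) {N : Subgroup H}
    (hN : commutator H ≤ N) {V₀ : H} {w₀ : Y → ℂ} (hfix : ∀ V ∈ N, (R V).1 *ᵥ w₀ = w₀)
    (hne : (R V₀).1 *ᵥ w₀ ≠ w₀) :
    ∃ (χ : H →* ℂ) (w : Y → ℂ), w ≠ 0 ∧ (∀ V, (R V).1 *ᵥ w = χ V • w) ∧ (∀ V ∈ N, χ V = 1) ∧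
      χ V₀ ≠ 1 := by
  have hmul (V W : H) (x : Y → ℂ) : (R V).1 *ᵥ ((R W).1 *ᵥ x) = (R (V * W)).1 *ᵥ x := by
    rw [Matrix.mulVec_mulVec, map_mul]; rfl
  let F : Submodule ℂ (Y → ℂ) :=
    { carrier := {x | ∀ V ∈ N, (R V).1 *ᵥ x = x}
      add_mem' := fun {x y} hx hy V hV => by rw [Matrix.mulVec_add, hx V hV, hy V hV]
      zero_mem' := fun V _ => Matrix.mulVec_zero _
      smul_mem' := fun c x hx V hV => by rw [Matrix.mulVec_smul, hx V hV] }
  have hFcomm {x : Y → ℂ} (hx : x ∈ F) (V W : H) :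
      (R (V * W)).1 *ᵥ x = (R (W * V)).1 *ᵥ x := by
    have h1 : V⁻¹ * W⁻¹ * V * W ∈ N := by
      refine hN ?_
      have := Subgroup.commutator_mem_commutator (Subgroup.mem_top V⁻¹) (Subgroup.mem_top W⁻¹)
      rwa [commutatorElement_def, inv_inv, inv_inv] at this
    have h2 : V * W = (W * V) * (V⁻¹ * W⁻¹ * V * W) := by group
    rw [h2, ← hmul, hx _ h1]
  have hFinv {x : Y → ℂ} (hx : x ∈ F) (V : H) : (R V).1 *ᵥ x ∈ F := by
    intro W hW
    rw [hmul, hFcomm hx, ← hmul, hx W hW]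
  -- the range of `R(V₀) - 1` on the fixed vectors of `N`; an eigenvector in it has `χ V₀ ≠ 1`
  let T : Subrepresentation (matRep R) :=
    { toSubmodule := F.map (Matrix.toLin' ((R V₀).1 - 1))
      apply_mem_toSubmodule := by
        rintro V _ ⟨x, hx, rfl⟩
        refine ⟨(R V).1 *ᵥ x, hFinv hx V, ?_⟩
        rw [matRep_apply, Matrix.toLin'_apply, Matrix.toLin'_apply, Matrix.sub_mulVec,
          Matrix.sub_mulVec, Matrix.mulVec_sub, Matrix.one_mulVec, Matrix.one_mulVec, hmul, hmul,
          hFcomm hx] }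
  have hTF : T.toSubmodule ≤ F := by
    rintro _ ⟨x, hx, rfl⟩
    rw [Matrix.toLin'_apply, Matrix.sub_mulVec, Matrix.one_mulVec]
    exact sub_mem (hFinv hx V₀) hx
  have hT : T.toSubmodule ≠ ⊥ := by
    rw [Submodule.ne_bot_iff]
    refine ⟨_, ⟨w₀, hfix, rfl⟩, ?_⟩
    rw [Matrix.toLin'_apply, Matrix.sub_mulVec, Matrix.one_mulVec]
    exact sub_ne_zero.mpr hne
  obtain ⟨W, hW, hWT⟩ := exists_irreducible_le hT
  obtain ⟨w, hw, hw0⟩ := exists_ne_zero_of_isIrreducible hW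
  have hscal (V : H) : ∃ c : ℂ, (R V).1 *ᵥ w = c • w := by
    let f : W.toRepresentation.IntertwiningMap W.toRepresentation :=
      ⟨W.toRepresentation V, fun V' => by
        ext1 x
        apply Subtype.ext
        show (R V).1 *ᵥ ((R V').1 *ᵥ x.1) = (R V').1 *ᵥ ((R V).1 *ᵥ x.1)
        rw [hmul, hmul, hFcomm (hTF (hWT x.2))]⟩
    obtain ⟨c, hc⟩ :=
      Representation.IsIrreducible.algebraMap_intertwiningMap_bijective_of_isAlgClosed.2 f
    exact ⟨c, (congrArg (fun F => (F ⟨w, hw⟩).1) hc).symm⟩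
  choose χ hχ using hscal
  have hcancel {a b : ℂ} (h : a • w = b • w) : a = b := smul_left_injective ℂ hw0 h
  refine ⟨⟨⟨χ, hcancel ?_⟩, fun V V' => hcancel ?_⟩, w, hw0, hχ, fun V hV => hcancel ?_, ?_⟩
  · rw [← hχ, map_one, one_smul]; exact Matrix.one_mulVec w
  · rw [← hχ, ← hmul, hχ, Matrix.mulVec_smul, hχ, smul_smul, mul_comm]
  · exact ((hχ V).symm.trans (hTF (hWT hw) V hV)).trans (one_smul ℂ w).symm
  · -- `w = R(V₀) y - y` is orthogonal to every vector fixed by `V₀`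
    intro h1
    have h1' : (R V₀).1 *ᵥ w = w := by
      rw [hχ]; exact (congrArg (· • w) h1).trans (one_smul ℂ w)
    obtain ⟨y, hy, hyw⟩ := hWT hw
    rw [Matrix.toLin'_apply, Matrix.sub_mulVec, Matrix.one_mulVec] at hyw
    have h2 : star w ⬝ᵥ ((R V₀).1 *ᵥ y) = star w ⬝ᵥ y := by
      conv_lhs => rw [← h1']
      rw [Matrix.star_mulVec, ← Matrix.dotProduct_mulVec, Matrix.mulVec_mulVec,
        ← Matrix.star_eq_conjTranspose, Matrix.mem_unitaryGroup_iff'.mp (R V₀).2, Matrix.one_mulVec]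
    have h3 : star w ⬝ᵥ ((R V₀).1 *ᵥ y - y) = 0 := by rw [dotProduct_sub, h2, sub_self]
    rw [hyw, star_dotProduct_self] at h3
    exact (sum_norm_sq_pos hw0).ne' (by exact_mod_cast h3)

end Eigenvector

/-! ### Weights of the moment representation -/

section TensorFamilies

variable {X : Type*}

/-- The tensor product of a family of matrices. -/
def tensorFam {t : ℕ} (A : Fin t → Matrix X X ℂ) : Matrix (Fin t → X) (Fin t → X) ℂ :=
  Matrix.of fun x y => ∏ i, A i (x i) (y i)

theorem tensorFam_smul {t : ℕ} (c : Fin t → ℂ) (A : Fin t → Matrix X X ℂ) :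
    (tensorFam fun i => c i • A i) = (∏ i, c i) • tensorFam A := by
  ext x y
  simp [tensorFam, Finset.prod_mul_distrib]

theorem tensorFam_mul [Fintype X] {t : ℕ} (A B : Fin t → Matrix X X ℂ) :
    tensorFam A * tensorFam B = tensorFam fun i => A i * B i := by
  ext x y
  simp only [tensorFam, Matrix.of_apply, Matrix.mul_apply]
  rw [Finset.prod_univ_sum, Fintype.piFinset_univ]
  simp only [Finset.prod_mul_distrib]

end TensorFamilies

section Weights

open scoped Kronecker

variable {X : Type*} [Fintype X] [DecidableEq X]

theorem tensorFam_const {t : ℕ} (A : Matrix X X ℂ) :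
    (tensorFam fun _ : Fin t => A) = tensorPow t A := rfl

theorem sum_tensorFam {t m : ℕ} (P : Fin m → Matrix X X ℂ) (hP : ∑ a, P a = 1) :
    ∑ a : Fin t → Fin m, tensorFam (fun i => P (a i)) = 1 := by
  rw [← map_one (tensorPow (X := X) t), ← hP]
  ext x y
  rw [Matrix.sum_apply]
  show _ = ∏ i, (∑ a, P a) (x i) (y i)
  simp only [Matrix.sum_apply]
  rw [Finset.prod_univ_sum, Fintype.piFinset_univ]
  rfl

theorem exists_tensorFam_mulVec_ne_zero {t m : ℕ} {P : Fin m → Matrix X X ℂ} (hP : ∑ a, P a = 1)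
    {w : (Fin t → X) × (Fin t → X) → ℂ} (hw : w ≠ 0) :
    ∃ a b : Fin t → Fin m, (tensorFam (fun i => P (a i)) ⊗ₖ
      tensorFam (fun i => (P (b i)).map star)) *ᵥ w ≠ 0 := by
  by_contra! hcon
  have hP' : ∑ a, (P a).map star = 1 := by
    have h := congrArg (fun A : Matrix X X ℂ => A.map (starRingEnd ℂ)) hP
    rw [Matrix.map_one _ (map_zero _) (map_one _)] at h
    rw [← h]
    ext i j
    rw [Matrix.sum_apply, Matrix.map_apply, Matrix.sum_apply, map_sum]
    rfl
  have h1 : (∑ a : Fin t → Fin m, ∑ b : Fin t → Fin m, tensorFam (fun i => P (a i)) ⊗ₖ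
      tensorFam (fun i => (P (b i)).map star)) = 1 := by
    have h2 : (∑ a : Fin t → Fin m, tensorFam (fun i => P (a i))) ⊗ₖ
        (∑ b : Fin t → Fin m, tensorFam (fun i => (P (b i)).map star)) = 1 := by
      rw [sum_tensorFam P hP, sum_tensorFam _ hP', Matrix.one_kronecker_one]
    rw [← h2]
    ext x y
    simp only [Matrix.sum_apply, Matrix.kroneckerMap_apply, Finset.sum_mul_sum]
  apply hw
  rw [← Matrix.one_mulVec w, ← h1, Matrix.sum_mulVec]
  refine Finset.sum_eq_zero fun a _ => ?_
  rw [Matrix.sum_mulVec]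
  exact Finset.sum_eq_zero fun b _ => hcon a b

variable {G : Type*} [Group G] {U : G →* Matrix.unitaryGroup X ℂ}

/-- A character of the group of invariant unitaries that occurs in the `t`-th moment representation
is given, on the phase gates of an orthogonal decomposition into irreducible subrepresentations, by
exponents whose absolute values add up to at most `2 t`. -/
theorem exists_weight {t m : ℕ} {W : Fin m → Subrepresentation (matRep U)}
    (hsum : ∑ a, projMat (W a) = 1)
    (horth : ∀ a b, a ≠ b → projMat (W a) * projMat (W b) = 0)
    {χ : invGroup U →* ℂ} {w : (Fin t → X) × (Fin t → X) → ℂ} (hw : w ≠ 0)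
    (hχ : ∀ V : invGroup U, (momentRep t V.1).1 *ᵥ w = χ V • w) :
    ∃ c : Fin m → ℤ, ∑ a, |c a| ≤ 2 * t ∧
      ∀ a z, χ (repGate (W a) z) = ((z ^ c a : Circle) : ℂ) := by
  classical
  obtain ⟨a, b, hab⟩ := exists_tensorFam_mulVec_ne_zero hsum hw
  -- the component `v` of `w` in a product of ranges of the projections is a weight vector for the
  -- phase gates: each gate acts by `z` on its own range and trivially on the others
  set v := (tensorFam (fun i => projMat (W (a i))) ⊗ₖ
      tensorFam (fun i => (projMat (W (b i))).map star)) *ᵥ w with hv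
  let α (j : Fin m) : ℕ := (Finset.univ.filter fun i => a i = j).card
  let β (j : Fin m) : ℕ := (Finset.univ.filter fun i => b i = j).card
  have hα : ∑ j, α j = t := by
    have := Finset.card_eq_sum_card_fiberwise (f := a) (s := Finset.univ) (t := Finset.univ)
      (by simp)
    simpa using this.symm
  have hβ : ∑ j, β j = t := by
    have := Finset.card_eq_sum_card_fiberwise (f := b) (s := Finset.univ) (t := Finset.univ)
      (by simp)
    simpa using this.symm
  refine ⟨fun j => α j - β j, ?_, fun j z => ?_⟩
  · calc ∑ j, |(α j : ℤ) - β j| ≤ ∑ j, ((α j : ℤ) + β j) := by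
          refine Finset.sum_le_sum fun j _ => ?_
          rw [abs_le]
          constructor <;> linarith [Int.natCast_nonneg (α j), Int.natCast_nonneg (β j)]
      _ = 2 * t := by
          rw [Finset.sum_add_distrib]
          have h1 : ∑ j, (α j : ℤ) = t := by exact_mod_cast hα
          have h2 : ∑ j, (β j : ℤ) = t := by exact_mod_cast hβ
          rw [h1, h2]; ring
  · have hPD (i : Fin m) : projMat (W i) * (repGate (W j) z).1.1 =
        (if i = j then (z : ℂ) else 1) • projMat (W i) := by
      rw [repGate_coe, mul_add, mul_one, mul_smul_comm]
      split_ifs with hij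
      · rw [hij, projMat_mul_self]; module
      · rw [horth i j hij, smul_zero, add_zero, one_smul]
    have hPD' (i : Fin m) : (projMat (W i)).map star * (repGate (W j) z).1.1.map star =
        star (if i = j then (z : ℂ) else 1) • (projMat (W i)).map star := by
      have h1 := congrArg (fun A : Matrix X X ℂ => A.map (starRingEnd ℂ)) (hPD i)
      simp only [Matrix.map_mul] at h1
      refine h1.trans ?_
      ext x y
      rw [Matrix.map_apply, Matrix.smul_apply, Matrix.smul_apply, smul_eq_mul, smul_eq_mul, map_mul]
      rfl
    have hprod (f : Fin t → Fin m) : (∏ i, if f i = j then (z : ℂ) else 1) =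
        (z : ℂ) ^ (Finset.univ.filter fun i => f i = j).card := by
      rw [Finset.prod_ite, Finset.prod_const, Finset.prod_const_one, mul_one]
    have h1 : (tensorFam (fun i => projMat (W (a i))) ⊗ₖ
        tensorFam (fun i => (projMat (W (b i))).map star)) * (momentRep t (repGate (W j) z).1).1 =
        ((z : ℂ) ^ α j * star (z : ℂ) ^ β j) • (tensorFam (fun i => projMat (W (a i))) ⊗ₖ
        tensorFam (fun i => (projMat (W (b i))).map star)) := by
      rw [momentRep_coe, ← tensorFam_const, ← tensorFam_const, ← Matrix.mul_kronecker_mul,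
        tensorFam_mul, tensorFam_mul]
      simp only [hPD, hPD']
      rw [tensorFam_smul, tensorFam_smul, Matrix.smul_kronecker, Matrix.kronecker_smul, smul_smul,
        hprod]
      have h2 : (∏ i, star (if b i = j then (z : ℂ) else 1)) = star (z : ℂ) ^ β j := by
        rw [← star_pow, ← hprod b]
        exact (map_prod (starRingEnd ℂ) _ _).symm
      rw [h2]
    have h2 : χ (repGate (W j) z) • v = ((z : ℂ) ^ α j * star (z : ℂ) ^ β j) • v := by
      rw [hv, ← Matrix.mulVec_smul, ← hχ, Matrix.mulVec_mulVec, h1, Matrix.smul_mulVec]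
    rw [smul_left_injective ℂ hab h2]
    have hz : star (z : ℂ) = ((z⁻¹ : Circle) : ℂ) := (Circle.coe_inv_eq_conj z).symm
    rw [hz, ← Circle.coe_pow, ← Circle.coe_pow, ← Circle.coe_mul]
    congr 1
    rw [inv_pow, zpow_sub, zpow_natCast, zpow_natCast]

end Weights

/-! ### The design criterion -/

section DesignCriterion

theorem zpow_sum_eq_prod_zpow {A ι : Type*} [CommGroup A] (z : A) (s : Finset ι) (c : ι → ℤ) :
    z ^ ∑ i ∈ s, c i = ∏ i ∈ s, z ^ c i := by
  classical
  induction s using Finset.induction_on with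
  | empty => simp
  | insert i s hi ih => rw [Finset.sum_insert hi, Finset.prod_insert hi, zpow_add, ih]

variable {X : Type*} [Fintype X] [DecidableEq X] {G : Type*} [Group G]
variable {U : G →* Matrix.unitaryGroup X ℂ}

open scoped Classical in
/-- The multiplicity of a class is the number of its members in any orthogonal decomposition. -/
theorem mult_eq_card {m : ℕ} {W : Fin m → Subrepresentation (matRep U)}
    (hW : ∀ a, (W a).toRepresentation.IsIrreducible) (hsum : ∑ a, projMat (W a) = 1)
    (l : Irreps (matRep U)) :
    l.mult = (Finset.univ.filter fun a => irrepClass (W a) (hW a) = l).card := by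
  let P (a : Fin m) : commutant U := ⟨projMat (W a), projMat_mem_commutant (W a)⟩
  have hP : ∑ a, P a = 1 := Subtype.ext (by
    rw [AddSubmonoidClass.coe_finsetSum]; exact hsum)
  have h : (l.mult : ℂ) = ∑ a, (blockRank l.rep.toRepresentation (P a) : ℂ) := by
    rw [← blockRank_one, blockRank_cast _ (by exact IsIdempotentElem.one), ← hP, map_sum, map_sum]
    exact Finset.sum_congr rfl fun a _ =>
      (blockRank_cast _ (A := P a) (projMat_mul_self (W a))).symm
  have h2 : l.mult = ∑ a, blockRank l.rep.toRepresentation (P a) := by exact_mod_cast h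
  rw [h2, Finset.card_filter]
  exact Finset.sum_congr rfl fun a _ => blockRank_projMat l (W a) (hW a)

theorem mult_pos (l : Irreps (matRep U)) : 0 < l.mult := by
  have h := blockRank_projMat l l.rep l.rep_isIrreducible
  rw [irrepClass_rep, if_pos rfl] at h
  calc 0 < blockRank l.rep.toRepresentation
        (⟨projMat l.rep, projMat_mem_commutant l.rep⟩ : commutant U) := by rw [h]; exact one_pos
    _ ≤ l.mult := Submodule.finrank_le _

/-- A character of the group of invariant unitaries that occurs in the `t`-th moment representation
is a product of powers of the determinants, with exponents `q` such that `∑_λ m_λ |q(λ)| ≤ 2 t`. -/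
theorem exists_eq_blockChar {t : ℕ} {χ : invGroup U →* ℂ} {w : (Fin t → X) × (Fin t → X) → ℂ}
    (hw : w ≠ 0) (hχ : ∀ V : invGroup U, (momentRep t V.1).1 *ᵥ w = χ V • w) :
    ∃ q : Irreps (matRep U) → ℤ, ∑ l, (l.mult : ℤ) * |q l| ≤ 2 * t ∧
      ∀ V, χ V = (blockChar q V : ℂ) := by
  classical
  obtain ⟨m, W, hW, hsum, horth⟩ := exists_orthogonal_decomposition U
  obtain ⟨c, hc, hχc⟩ := exists_weight hsum horth hw hχ
  have hval (V : invGroup U) : (χ.toHomUnits V : ℂ) = χ V := rfl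
  -- the exponent at a subrepresentation of the decomposition depends only on its class
  have hclass (a : Fin m) (z : Circle) :
      χ (repGate (irrepClass (W a) (hW a)).rep z) = ((z ^ c a : Circle) : ℂ) := by
    obtain ⟨e⟩ := irrepClass_eq_iff.mp (rfl : irrepClass (W a) (hW a) = _)
    rw [← hχc, ← hval, ← hval,
      map_repGate_eq_of_equiv χ.toHomUnits (hW a) (Irreps.rep_isIrreducible _) e]
  have hex (l : Irreps (matRep U)) : ∃ a, irrepClass (W a) (hW a) = l := by
    have h := mult_pos l
    rw [mult_eq_card hW hsum] at h
    obtain ⟨a, ha⟩ := Finset.card_pos.mp h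
    exact ⟨a, (Finset.mem_filter.mp ha).2⟩
  choose b hb using hex
  have hcb (a : Fin m) : c a = c (b (irrepClass (W a) (hW a))) :=
    circle_zpow_injective fun z => Circle.ext (by rw [← hclass, ← hclass, hb])
  refine ⟨fun l => c (b l), ?_, fun V => ?_⟩
  · refine le_of_eq_of_le ?_ hc
    rw [← Finset.sum_fiberwise Finset.univ fun a => irrepClass (W a) (hW a)]
    refine Finset.sum_congr rfl fun l _ => ?_
    rw [Finset.sum_congr rfl (g := fun _ => |c (b l)|) fun a ha => ?_, Finset.sum_const,
      mult_eq_card hW hsum, nsmul_eq_mul]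
    rw [hcb a, (Finset.mem_filter.mp ha).2]
  · rw [← hval, map_eq_prod_repGate_phase, blockChar_apply, Units.coe_prod]
    refine Eq.trans ?_ (map_prod Circle.coeHom _ _).symm
    refine Finset.prod_congr rfl fun l _ => ?_
    rw [hval]
    refine Eq.trans ?_ (hclass (b l) _)
    rw [hb]

/-- A character that is trivial on the global phases has exponents with `∑_λ m_λ q(λ) = 0`. -/
theorem sum_mult_mul_eq_zero {q : Irreps (matRep U) → ℤ}
    (hq : ∀ z, blockChar q (gate (.one _) (one_mem (commutant U)) z) = 1) :
    ∑ l, (l.mult : ℤ) * q l = 0 := by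
  refine circle_zpow_injective fun z => ?_
  rw [zpow_zero, ← hq z, blockChar_apply, zpow_sum_eq_prod_zpow]
  refine Finset.prod_congr rfl fun l _ => ?_
  rw [phase_gate, zpow_mul, zpow_natCast]
  congr 2
  exact (blockRank_one l).symm

variable {K : Subgroup (Matrix.unitaryGroup X ℂ)} {μ ν : Measure (Matrix.unitaryGroup X ℂ)}

/-- For a group of invariant unitaries that contains the commutators and the global phases, being a
`t`-design is obstructed exactly by the nontrivial products of powers of determinants that are
trivial on this group and have degree at most `t`. -/
theorem isTDesign_iff [CompactSpace K] [CompactSpace (invGroup U)] (hK : K ≤ invGroup U)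
    (hcomm : ∀ V ∈ commutator (invGroup U), V.1 ∈ K)
    (hphase : ∀ z, (gate (.one _) (one_mem (commutant U)) z).1 ∈ K)
    (hμ : IsUniformOn K μ) (hν : IsUniformOn (invGroup U) ν) (t : ℕ) :
    IsTDesign t μ ν ↔ ∀ q : Irreps (matRep U) → ℤ, q ≠ 0 →
      (∀ V : invGroup U, V.1 ∈ K → blockChar q V = 1) →
      (2 * t : ℤ) < ∑ l, (l.mult : ℤ) * |q l| := by
  constructor
  · intro hd q hq hqK
    by_contra! hle
    have hbal := sum_mult_mul_eq_zero fun z => hqK _ (hphase z)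
    obtain ⟨f, hf, hfq⟩ := exists_polySpan_eq_blockChar q
    have hpos : ((∑ l, l.mult * (q l).toNat : ℕ) : ℤ) - ((∑ l, l.mult * (-q l).toNat : ℕ) : ℤ) =
        ∑ l, (l.mult : ℤ) * q l := by
      push_cast
      rw [← Finset.sum_sub_distrib]
      refine Finset.sum_congr rfl fun l _ => ?_
      rw [← mul_sub]; congr 1; omega
    have hneg : ((∑ l, l.mult * (q l).toNat : ℕ) : ℤ) + ((∑ l, l.mult * (-q l).toNat : ℕ) : ℤ) =
        ∑ l, (l.mult : ℤ) * |q l| := by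
      push_cast
      rw [← Finset.sum_add_distrib]
      refine Finset.sum_congr rfl fun l _ => ?_
      rw [← mul_add]; congr 1; rcases abs_cases (q l) with h | h <;> omega
    -- the character is a polynomial of balanced degree, half of `∑_λ m_λ |q(λ)|`
    have hab : (∑ l, l.mult * (-q l).toNat) = ∑ l, l.mult * (q l).toNat := by omega
    rw [hab] at hf hneg
    have hX : Nonempty X := by
      obtain ⟨l, -⟩ := Function.ne_iff.mp hq
      obtain ⟨x, -, hx⟩ := exists_ne_zero_of_isIrreducible l.rep_isIrreducible
      exact (Function.ne_iff.mp hx).nonempty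
    -- multiplication by the polynomial `1` of balanced degree raises the degree to `t`
    have hft : f ∈ polySpan X t t := by
      have h := Submodule.mul_mem_mul hf
        (one_mem_polySpan (X := X) (t - ∑ l, l.mult * (q l).toNat))
      rw [mul_one, polySpan_mul, Nat.add_sub_cancel' (by omega)] at h
      exact h
    obtain ⟨hμ', η, -, hη', hint⟩ := exists_isHaar_of_isUniformOn hμ
    obtain ⟨hν', η', hη₁, -, hint'⟩ := exists_isHaar_of_isUniformOn hν
    obtain ⟨hfc, heq⟩ := integral_eq_of_isTDesign hd hft
    have h1 : ∫ V, f V ∂μ = 1 := by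
      rw [hint f hfc]
      have h (V : K) : f V.1 = 1 := by
        rw [hfq ⟨V.1, hK V.2⟩, hqK ⟨V.1, hK V.2⟩ V.2, Circle.coe_one]
      simp [h]
    have h0 : ∫ V, f V ∂ν = 0 := by
      rw [hint' f hfc]
      simp only [hfq]
      obtain ⟨V₀, hV₀⟩ := exists_blockChar_ne_one hq
      exact integral_character_eq_zero (blockChar q) hV₀
    rw [h1, h0] at heq
    exact one_ne_zero heq
  · intro h
    refine moment_eq_of_forall_mul_eq hK hμ hν fun V₀ hV₀ => ?_
    by_contra hne
    -- some column of the moment is fixed by `K` and not by `V₀`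
    obtain ⟨j, hj⟩ : ∃ j, (momentRep t V₀).1 *ᵥ (moment t μ).col j ≠ (moment t μ).col j := by
      by_contra! hcon
      refine hne (Matrix.ext_col fun j => ?_)
      exact hcon j
    obtain ⟨χ, w, hw, hχ, hχK, hχV⟩ := exists_character_of_not_fixed
      (R := (momentRep t).comp (invGroup U).subtype) (N := K.subgroupOf (invGroup U))
      (V₀ := ⟨V₀, hV₀⟩) (w₀ := (moment t μ).col j)
      (fun V hV => hcomm V hV)
      (fun V hV => congrArg (fun M => M.col j) (momentRep_mul_moment hμ t hV)) hj
    obtain ⟨q, hqt, hqχ⟩ := exists_eq_blockChar hw hχ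
    refine absurd (h q ?_ fun V hV => Circle.ext ?_) (not_lt.mpr hqt)
    · rintro rfl
      refine hχV ?_
      rw [hqχ, blockChar_apply]
      simp
    · rw [← hqχ, hχK V hV, Circle.coe_one]

end DesignCriterion

/-! ### Admissible vectors -/

section NullVectors

variable {G : Type*} [Group G] {d k n : ℕ} {u : G →* Matrix.unitaryGroup (Fin d) ℂ}
/-- The global phases are local gates. -/
theorem gate_one_mem_circuitGroup (hkn : k ≤ n) (z : Circle) :
    (gate (.one _) (one_mem (commutant (tensorUnitary u n))) z).1 ∈ circuitGroup u n k := by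
  have e : Fin k ⊕ Fin (n - k) ≃ Fin n :=
    finSumFinEquiv.trans (finCongr (Nat.add_sub_cancel' hkn))
  have h := embU_mem_circuitGroup e (gate (.one _) (one_mem (commutant (tensorUnitary u k))) z)
  convert h using 1
  refine Subtype.ext ?_
  show (1 + ((z : ℂ) - 1) • 1 : Matrix (Fin n → Fin d) (Fin n → Fin d) ℂ) =
    emb e (1 + ((z : ℂ) - 1) • 1)
  rw [map_add, map_smul, map_one]

variable [TopologicalSpace G] [IsTopologicalGroup G] [CompactSpace G] [MeasurableSpace G]
  [BorelSpace G]

/-- The admissible vectors `q` are the exponents of the characters that are trivial on the group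
generated by the local invariant unitaries. -/
theorem sMatrix_mulVec_eq_zero_iff (hkn : k ≤ n) (hu : Continuous u)
    (hsemi : IsSemiUniversal u n k) (q : Irreps (matRep (tensorUnitary u n)) → ℤ) :
    sMatrix u n k *ᵥ (fun l => (q l : ℂ)) = 0 ↔
      ∀ V : invGroup (tensorUnitary u n), V.1 ∈ circuitGroup u n k → blockChar q V = 1 := by
  obtain ⟨s, hs⟩ := exists_sMatrix_eq_natCast hkn hu
  have h1 : sMatrix u n k *ᵥ (fun l => (q l : ℂ)) = 0 ↔ ∀ ν, ∑ l, (s ν l : ℤ) * q l = 0 := by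
    rw [funext_iff]
    refine forall_congr' fun ν => ?_
    rw [← Int.cast_inj (α := ℂ), Int.cast_sum, Int.cast_zero]
    refine Eq.congr (Finset.sum_congr rfl fun l _ => ?_) rfl
    rw [Int.cast_mul, Int.cast_natCast]
    exact congrArg (· * (q l : ℂ)) (hs ν l)
  have h2 (θ : Irreps (matRep (tensorUnitary u k)) → Circle) :
      ∏ l, torusHom s θ l ^ q l = ∏ ν, θ ν ^ ∑ l, (s ν l : ℤ) * q l := by
    simp only [torusHom_apply, zpow_sum_eq_prod_zpow, zpow_mul, zpow_natCast, ← Finset.prod_zpow]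
    exact Finset.prod_comm
  rw [h1]
  constructor
  · intro h V hV
    obtain ⟨θ, hθ⟩ := (mem_circuitGroup_iff hkn hu hsemi hs V).mp hV
    rw [blockChar_apply]
    simp only [← phases_apply, ← hθ]
    rw [h2]
    simp [h]
  · intro h ν
    refine circle_zpow_injective fun z => ?_
    classical
    obtain ⟨V, hV⟩ := exists_phase_eq (U := tensorUnitary u n) (torusHom s (Pi.mulSingle ν z))
    have h3 := h V ((mem_circuitGroup_iff hkn hu hsemi hs V).mpr ⟨_, hV.symm⟩)
    rw [blockChar_apply] at h3
    simp only [← phases_apply, hV] at h3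
    rw [h2, Finset.prod_eq_single ν (fun ν' _ hν' => by
      rw [Pi.mulSingle_eq_of_ne hν', one_zpow]) (by simp), Pi.mulSingle_eq_same] at h3
    rw [h3, zpow_zero]

/-- The design property fails exactly from the degree `m · |q| / 2` of an admissible vector on. -/
theorem isTDesign_circuitGroup_iff (hkn : k ≤ n) (hu : Continuous u)
    (hsemi : IsSemiUniversal u n k) {μ ν : Measure (Matrix.unitaryGroup (Fin n → Fin d) ℂ)}
    (hμ : IsUniformOn (circuitGroup u n k) μ) (hν : IsUniformOn (circuitGroup u n n) ν) (t : ℕ) :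
    IsTDesign t μ ν ↔ ∀ q ∈ nullVectors u n k, (2 * t : ℤ) < multDotAbs q := by
  have h1 := isCompact_circuitGroup hkn hu hsemi
  have h2 := isCompact_circuitGroup_self n u
  rw [circuitGroup_self_eq] at h2 hν
  have := isCompact_iff_compactSpace.mp h1
  have := isCompact_iff_compactSpace.mp h2
  rw [isTDesign_iff (circuitGroup_le u n k) (fun V => mem_circuitGroup_of_mem_commutator hsemi)
    (gate_one_mem_circuitGroup hkn) hμ hν]
  refine forall_congr' fun q => ?_
  rw [← sMatrix_mulVec_eq_zero_iff hkn hu hsemi]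
  exact and_imp.symm

/-- The pairing `m · |q|` of an admissible vector is even and positive. -/
theorem exists_multDotAbs_eq (hkn : k ≤ n) (hu : Continuous u)
    (hsemi : IsSemiUniversal u n k) {q : Irreps (onSiteRep u n) → ℤ} (hq : q ∈ nullVectors u n k) :
    ∃ T : ℕ, multDotAbs q = 2 * (T + 1) := by
  have hbal := sum_mult_mul_eq_zero (U := tensorUnitary u n) fun z =>
    (sMatrix_mulVec_eq_zero_iff hkn hu hsemi q).mp hq.2 _ (gate_one_mem_circuitGroup hkn z)
  -- `∑_λ m_λ |q(λ)|` and `∑_λ m_λ q(λ) = 0` have the same parity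
  have hev : Even (multDotAbs q) := by
    have h : multDotAbs q = multDotAbs q + ∑ l : Irreps (matRep (tensorUnitary u n)),
      (l.mult : ℤ) * q l := by rw [hbal, add_zero]
    rw [h]
    show Even ((∑ l : Irreps (matRep (tensorUnitary u n)), (l.mult : ℤ) * |q l|) + _)
    rw [← Finset.sum_add_distrib]
    refine Finset.even_sum _ fun l _ => ?_
    rw [← mul_add]
    refine Even.mul_left ?_ _
    rcases abs_choice (q l) with h | h <;> rw [h]
    · exact ⟨q l, rfl⟩
    · exact ⟨0, by ring⟩
  have hpos : 0 < multDotAbs q := by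
    obtain ⟨l, hl⟩ := Function.ne_iff.mp hq.1
    refine Finset.sum_pos' (fun l _ => by positivity) ⟨l, Finset.mem_univ l, ?_⟩
    have h1 : 0 < l.mult := mult_pos (U := tensorUnitary u n) l
    exact mul_pos (by exact_mod_cast h1) (abs_pos.mpr hl)
  obtain ⟨r, hr⟩ := hev
  exact ⟨(r - 1).toNat, by omega⟩

end NullVectors

end SymmetricDesign

end

open SymmetricDesign
theorem mainTheorem3 {G : Type*} [Group G] [TopologicalSpace G] [IsTopologicalGroup G]
    [CompactSpace G] [MeasurableSpace G] [BorelSpace G] (d n k : ℕ) (hkn : k ≤ n)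
    (u : G →* Matrix.unitaryGroup (Fin d) ℂ) (hu : Continuous u)
    (hsemi : IsSemiUniversal u n k) :
    -- the entries of `S` are non-negative integers
    (∀ ν l, ∃ a : ℕ, sMatrix u n k ν l = (a : ℂ)) ∧
    -- both groups are compact, so that they carry a (unique) uniform distribution
    IsCompact (circuitGroup u n k : Set (Matrix.unitaryGroup (Fin n → Fin d) ℂ)) ∧
    IsCompact (circuitGroup u n n : Set (Matrix.unitaryGroup (Fin n → Fin d) ℂ)) ∧
    ∀ μ ν : Measure (Matrix.unitaryGroup (Fin n → Fin d) ℂ),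
      IsUniformOn (circuitGroup u n k) μ → IsUniformOn (circuitGroup u n n) ν →
        -- `μ` is a `t`-design for `ν` exactly up to `tMax μ ν`
        (∀ t : ℕ, IsTDesign t μ ν ↔ (t : ℕ∞) ≤ tMax μ ν) ∧
        -- `tMax μ ν` is the minimum of `m · |q| / 2 - 1` over all admissible `q`
        ((nullVectors u n k).Nonempty → ∃ T : ℕ, tMax μ ν = (T : ℕ∞) ∧
          IsLeast ((fun q => (multDotAbs q : ℚ) / 2 - 1) '' nullVectors u n k) (T : ℚ)) ∧
        -- and it is infinite if there is no admissible `q`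
        (nullVectors u n k = ∅ → tMax μ ν = ⊤) := by
  obtain ⟨s, hs⟩ := exists_sMatrix_eq_natCast hkn hu
  refine ⟨fun ν l => ⟨s ν l, hs ν l⟩, isCompact_circuitGroup hkn hu hsemi,
    isCompact_circuitGroup_self n u, fun μ ν hμ hν => ?_⟩
  have hd (t : ℕ) := isTDesign_circuitGroup_iff hkn hu hsemi hμ hν t
  have htop (h : nullVectors u n k = ∅) : tMax μ ν = ⊤ :=
    ENat.eq_top_iff_forall_ge.mpr fun t =>
      le_iSup₂_of_le t ((hd t).mpr (by simp [h])) le_rfl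
  have hmin (h : (nullVectors u n k).Nonempty) : ∃ q₀ ∈ nullVectors u n k, ∃ T : ℕ,
      multDotAbs q₀ = 2 * (T + 1) ∧ (∀ q ∈ nullVectors u n k, multDotAbs q₀ ≤ multDotAbs q) ∧
      (∀ t, IsTDesign t μ ν ↔ t ≤ T) ∧ tMax μ ν = T := by
    obtain ⟨q₀, hq₀, hle⟩ := exists_minimalFor_of_wellFoundedLT (· ∈ nullVectors u n k)
      (fun q => (multDotAbs q).toNat) h
    obtain ⟨T, hT⟩ := exists_multDotAbs_eq hkn hu hsemi hq₀
    have hle' (q) (hq : q ∈ nullVectors u n k) : multDotAbs q₀ ≤ multDotAbs q := by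
      obtain ⟨T', hT'⟩ := exists_multDotAbs_eq hkn hu hsemi hq
      rcases le_total (multDotAbs q₀).toNat (multDotAbs q).toNat with h | h
      · omega
      · have := hle hq h
        simp only at this
        omega
    have ht (t : ℕ) : IsTDesign t μ ν ↔ t ≤ T := by
      rw [hd]
      constructor
      · intro h
        have := h q₀ hq₀
        omega
      · intro h q hq
        have := hle' q hq
        omega
    refine ⟨q₀, hq₀, T, hT, hle', ht, le_antisymm ?_ ?_⟩
    · exact iSup₂_le fun t h => by exact_mod_cast (ht t).mp h
    · exact le_iSup₂_of_le T ((ht T).mpr le_rfl) le_rfl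
  refine ⟨fun t => ?_, fun h => ?_, htop⟩
  · rcases (nullVectors u n k).eq_empty_or_nonempty with h | h
    · rw [htop h, hd, h]
      simp
    · obtain ⟨q₀, -, T, -, -, ht, hT⟩ := hmin h
      rw [hT, ht, Nat.cast_le]
  · obtain ⟨q₀, hq₀, T, hq₀T, hle, -, hT⟩ := hmin h
    have hcast : (multDotAbs q₀ : ℚ) = 2 * (T + 1) := by exact_mod_cast hq₀T
    refine ⟨T, hT, ⟨q₀, hq₀, by simp only [hcast]; ring⟩, ?_⟩
    rintro _ ⟨q, hq, rfl⟩
    have h1 : (multDotAbs q₀ : ℚ) ≤ multDotAbs q := by exact_mod_cast hle q hq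
    rw [hcast] at h1
    simp only
    linarith
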